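/- Let $t\in(0,1)$ be fixed, and let $(A_\nu,B_\nu)_{\nu\ge 0}$ be a sequence of ordered pairs of Lebesgue measurable subsets of $\mathbb{R}^2$ of finite measure such that $$|A_\nu|\to 1,\qquad |B_\nu|\to 1,\qquad |tA_\nu+(1-t)B_\nu|\to 1\qquad\text{as }\nu\to\infty .$$ Here $|\cdot|$ denotes Lebesgue measure (Lebesgue outer measure, if $tA_\nu+(1-t)B_\nu$ is not measurable) and $tA+(1-t)B=\{ta+(1-t)b : a\in A,\ b\in B\}$. Then there exist Lebesgue measure-preserving affine automorphisms $\Phi_\nu$ of $\mathbb{R}^2$ and vectors $v_\nu\in\mathbb{R}^2$ such that the two sequences of indicator functions $(\mathbf 1_{\Phi_\nu(A_\nu)})_\nu$ and $(\mathbf 1_{\Phi_\nu(B_\nu)+v_\nu})_\nu$ are precompact in $L^2(\mathbb{R}^2)$; that is, all their terms lie in $L^2(\mathbb{R}^2)$ and the set of terms of each sequence has compact closure in $L^2(\mathbb{R}^2)$. -/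

import Mathlib

open MeasureTheory Filter Topology
open scoped Pointwise ENNReal

/-- The Euclidean plane `ℝ²`; its `volume` is Lebesgue measure. -/
abbrev Plane : Type := EuclideanSpace ℝ (Fin 2)

/-- A sequence of functions on the plane is precompact in `L²(ℝ²)`: every term belongs to `L²(ℝ²)`,
and the set of the terms (as elements of the space `L²(ℝ²)`) has compact closure in the norm
topology. -/
def PrecompactInL2 (f : ℕ → Plane → ℝ) : Prop :=
  ∃ hf : ∀ n, MemLp (f n) 2 (volume : Measure Plane),
    IsCompact (closure (Set.range fun n => (hf n).toLp (f n)))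

/-- The indicator function of a subset of the plane. -/
noncomputable def indicatorFun (E : Set Plane) : Plane → ℝ :=
  E.indicator fun _ => 1

/-! The hypotheses say that $X=tA_\nu$ and $Y=(1-t)B_\nu$ are asymptotically extremal for the planar
Brunn-Minkowski inequality $|X+Y|\ge(\sqrt{|X|}+\sqrt{|Y|})^2$. The proof is a stability analysis of
the slicing proof of that inequality.

Let $a,b$ be the suprema of the lengths of the vertical slices of $X,Y$. By Brunn-Minkowski on
slices, the superlevel sets of the two slice-length functions at heights $as$ and $bs$ add up to a
subset of the superlevel set of $X+Y$ at height $(a+b)s$. Brunn-Minkowski on the line for these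
sets, integrated over $s\in(0,1)$, gives $|X+Y|\ge(a+b)(|X|/a+|Y|/b)\ge(\sqrt{|X|}+\sqrt{|Y|})^2$.
Near equality thus forces near equality on the line in two places: at some low superlevel set, so
that $X$ is concentrated over an interval (`NearEquality.exists_localization`), and on most slices,
which are close to intervals (`NearEquality.exists_nearInterval_slices`). The stability result on
the line, `nearInterval_of_measureReal_add_lt`, rests on Freiman's inequality, which in turn comes
from Cauchy-Davenport on a circle.

Near equality survives measure-preserving linear maps, so all this holds in every direction.
Normalize $X$ so that its vertical slices have supremum 1 and, among the nonvertical directions, the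
horizontal one has nearly the longest slices. Were the horizontal slices short, every nonvertical
line would meet $X$ in a short set, usually a near-interval, and few pairs of points of $X$ would be
far apart horizontally; this contradicts $|X|\ge m$ with vertical slices of length at most 1
(`exists_le_sliceSup_slant_zero`). Hence both sets lie, up to small measure, in boxes of bounded
size, with near-intervals as most horizontal and vertical slices. Such a set is close to a union of
squares of a fixed finite grid (`exists_gridSet_approx`). Finitely many such unions exist, which is
total boundedness in $L^2$. -/

/-! ### Brunn-Minkowski on the line. -/

theorem Real.volume_real_image_add_const (c : ℝ) (X : Set ℝ) :
    volume.real ((fun x => x + c) '' X) = volume.real X := by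
  simp [measureReal_def]

/-- The sumset contains the translates $X+\min Y$ and $\max X+Y$, which meet in one point only. -/
theorem IsCompact.measureReal_add_le_measureReal_add {X Y : Set ℝ} (hX : IsCompact X)
    (hY : IsCompact Y) (hX0 : X.Nonempty) (hY0 : Y.Nonempty) :
    volume.real X + volume.real Y ≤ volume.real (X + Y) := by
  have hx1 := hX.sSup_mem hX0
  have hy0 := hY.sInf_mem hY0
  set x1 := sSup X
  set y0 := sInf Y
  have hU : IsCompact ((fun x => x + y0) '' X) := hX.image (by fun_prop)
  have hV : IsCompact ((fun x => x + x1) '' Y) := hY.image (by fun_prop)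
  have hW := (hX.add hY).measure_ne_top (μ := volume)
  have h := measureReal_union_add_inter (μ := volume) (s := (fun x => x + y0) '' X)
    hV.measurableSet hU.measure_ne_top hV.measure_ne_top
  have hI : volume.real ((fun x => x + y0) '' X ∩ (fun x => x + x1) '' Y) = 0 := by
    have hsub : (fun x => x + y0) '' X ∩ (fun x => x + x1) '' Y ⊆ {x1 + y0} := by
      rintro z ⟨⟨x, hx, rfl⟩, ⟨y, hy, hxy⟩⟩
      have h1 : x ≤ x1 := le_csSup hX.bddAbove hx
      have h2 : y0 ≤ y := csInf_le hY.bddBelow hy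
      simp only [Set.mem_singleton_iff]
      linarith
    exact measureReal_mono_null hsub (by simp [measureReal_def]) (by simp)
  rw [hI, Real.volume_real_image_add_const, Real.volume_real_image_add_const] at h
  have hsub : (fun x => x + y0) '' X ∪ (fun x => x + x1) '' Y ⊆ X + Y := by
    rintro z (⟨x, hx, rfl⟩ | ⟨y, hy, rfl⟩)
    · exact Set.add_mem_add hx hy0
    · exact ⟨x1, hx1, y, hy, add_comm _ _⟩
  have := measureReal_mono (μ := volume) hsub hW
  linarith

/-- Inner regularity reduces to compact sets; the points `x0` and `y0` are inserted to keep these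
nonempty. The sumset itself need not be measurable. -/
theorem measure_add_le_measure_add_of_measurableSet {X Y : Set ℝ} (hX : MeasurableSet X)
    (hY : MeasurableSet Y) (hX0 : X.Nonempty) (hY0 : Y.Nonempty) :
    volume X + volume Y ≤ volume (X + Y) := by
  obtain ⟨x0, hx0⟩ := hX0
  obtain ⟨y0, hy0⟩ := hY0
  have hsup : ∀ Z : Set ℝ, MeasurableSet Z →
      volume Z = ⨆ (K : Set ℝ) (_ : K ⊆ Z ∧ IsCompact K), volume K := fun Z hZ => by
    rw [hZ.measure_eq_iSup_isCompact]
    simp only [iSup_and]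
  rw [hsup X hX, hsup Y hY]
  refine ENNReal.biSup_add_biSup_le' ⟨∅, by simp⟩ ⟨∅, by simp⟩ fun K ⟨hK, hKc⟩ L ⟨hL, hLc⟩ => ?_
  have hKc' := hKc.insert x0
  have hLc' := hLc.insert y0
  have h := hKc'.measureReal_add_le_measureReal_add hLc' ⟨x0, by simp⟩ ⟨y0, by simp⟩
  calc volume K + volume L ≤ volume (insert x0 K) + volume (insert y0 L) := by
        gcongr <;> exact Set.subset_insert _ _
    _ ≤ volume (insert x0 K + insert y0 L) := by
        rw [← ENNReal.toReal_le_toReal (by simp [hKc'.measure_ne_top, hLc'.measure_ne_top])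
          (hKc'.add hLc').measure_ne_top,
          ENNReal.toReal_add hKc'.measure_ne_top hLc'.measure_ne_top]
        exact h
    _ ≤ volume (X + Y) := by
        gcongr
        · exact Set.insert_subset hx0 hK
        · exact Set.insert_subset hy0 hL

/-! ### Cauchy-Davenport on the circle and Freiman's inequality. -/

/-- The residues of the cells `[iD/p, (i+1)D/p)` which meet `X ∩ [0, D)`. -/
noncomputable def cellResidues (p : ℕ) [NeZero p] (D : ℝ) (X : Set ℝ) : Finset (ZMod p) :=
  open Classical in
  Finset.univ.filter fun i => ∃ x ∈ X, x < D ∧ (⌊x / (D / p)⌋₊ : ZMod p) = i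

theorem floor_cell_bounds {e x : ℝ} (he : 0 < e) (hx : 0 ≤ x) :
    (⌊x / e⌋₊ : ℝ) * e ≤ x ∧ x < (⌊x / e⌋₊ + 1) * e := by
  constructor
  · rw [← le_div_iff₀ he]
    exact Nat.floor_le (by positivity)
  · rw [← div_lt_iff₀ he]
    exact Nat.lt_floor_add_one _

theorem measureReal_le_card_cellResidues {p : ℕ} [NeZero p] {D : ℝ} (hD : 0 < D) {X : Set ℝ}
    (hX : X ⊆ Set.Icc 0 D) :
    volume.real X ≤ (cellResidues p D X).card * (D / p) := by
  have hp : (0 : ℝ) < p := by exact_mod_cast Nat.pos_of_ne_zero (NeZero.ne p)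
  set e := D / p with he
  have he0 : 0 < e := by positivity
  set U : Set ℝ := ⋃ i ∈ cellResidues p D X, Set.Ico ((i.val : ℝ) * e) ((i.val + 1) * e) with hU
  have hsub : X ⊆ U ∪ {D} := by
    intro x hx
    by_cases hxD : x < D
    · left
      have hlt : ⌊x / e⌋₊ < p := by
        rw [Nat.floor_lt (div_nonneg (hX hx).1 he0.le), div_lt_iff₀ he0, he]
        field_simp
        exact hxD
      refine Set.mem_iUnion₂.2 ⟨(⌊x / e⌋₊ : ZMod p), ?_, ?_⟩
      · simp only [cellResidues, Finset.mem_filter, Finset.mem_univ, true_and]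
        exact ⟨x, hx, hxD, rfl⟩
      · rw [ZMod.val_natCast_of_lt hlt]
        exact floor_cell_bounds he0 (hX hx).1
    · right
      exact le_antisymm (hX hx).2 (not_lt.1 hxD)
  have hUle : volume.real U ≤ (cellResidues p D X).card * e := by
    refine (measureReal_biUnion_finset_le _ _).trans ?_
    rw [← nsmul_eq_mul, ← Finset.sum_const]
    refine Finset.sum_le_sum fun i _ => ?_
    rw [Real.volume_real_Ico]
    exact max_le (by ring_nf; rfl) he0.le
  have hUfin : volume (U ∪ {D}) ≠ ∞ := by
    refine (measure_union_lt_top ?_ (by simp)).ne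
    refine (measure_biUnion_finset_le _ _).trans_lt ?_
    exact ENNReal.sum_lt_top.2 fun i _ => by simp
  calc volume.real X ≤ volume.real (U ∪ {D}) := measureReal_mono hsub hUfin
    _ ≤ volume.real U + volume.real {D} := measureReal_union_le _ _
    _ ≤ _ := by simpa [measureReal_def] using hUle

/-- The continuous Cauchy-Davenport inequality on a circle of length `D`. -/
theorem min_le_measureReal_add_mod {X Y : Set ℝ} {D : ℝ} (hD : 0 < D) (hX : IsCompact X)
    (hY : IsCompact Y) (hXD : X ⊆ Set.Icc 0 D) (hYD : Y ⊆ Set.Icc 0 D) (hX0 : (0 : ℝ) ∈ X)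
    (hY0 : (0 : ℝ) ∈ Y) :
    min D (volume.real X + volume.real Y) ≤
      volume.real (((X + Y) ∪ (fun x => x + (-D)) '' (X + Y)) ∩ Set.Icc 0 D) := by
  set W := (X + Y) ∪ (fun x => x + (-D)) '' (X + Y) with hW
  have hWc : IsCompact W := (hX.add hY).union ((hX.add hY).image (by fun_prop))
  set μ := (volume : Measure ℝ).restrict (Set.Icc 0 D) with hμ
  have hμr : ∀ s, μ.real s = volume.real (s ∩ Set.Icc 0 D) := fun s => by
    rw [measureReal_def, hμ, Measure.restrict_apply' measurableSet_Icc, measureReal_def]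
  rw [← hμr]
  -- Since `W` is closed, its small thickenings have nearly its measure, so the discrete sumset only
  -- has to be located up to a small distance.
  have hlim : Tendsto (fun r => μ.real (Metric.cthickening r W)) (𝓝 0) (𝓝 (μ.real W)) :=
    (ENNReal.tendsto_toReal (measure_ne_top _ _)).comp
      (tendsto_measure_cthickening_of_isClosed ⟨1, one_pos, measure_ne_top _ _⟩ hWc.isClosed)
  refine le_of_forall_pos_le_add fun η hη => ?_
  obtain ⟨r, hr, hrW⟩ := Metric.eventually_nhds_iff.1
    (hlim.eventually (gt_mem_nhds (show μ.real W < μ.real W + η / 2 by linarith)))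
  -- A prime number of cells, so that Cauchy-Davenport applies in `ZMod p`; it is so large that a
  -- cell has length below `r / 2` and at most `η / 2`.
  obtain ⟨p, hpn, hp⟩ := Nat.exists_infinite_primes (⌈max (4 * D / r) (2 * D / η)⌉₊ + 1)
  have : NeZero p := ⟨hp.ne_zero⟩
  have hp0 : (0 : ℝ) < p := by exact_mod_cast hp.pos
  have hple : max (4 * D / r) (2 * D / η) ≤ p := (Nat.le_ceil _).trans (by exact_mod_cast by omega)
  set e := D / p with he
  have he0 : 0 < e := by positivity
  have hpe : p * e = D := by rw [he]; field_simp
  have her : 2 * e < r := by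
    have := (le_max_left _ _).trans hple
    rw [div_le_iff₀ hr] at this
    rw [he, mul_div_assoc', div_lt_iff₀ hp0]
    nlinarith
  have heη : e ≤ η / 2 := by
    have := (le_max_right _ _).trans hple
    rw [div_le_iff₀ hη] at this
    rw [he, div_le_iff₀ hp0]
    nlinarith
  have hne : ∀ Z : Set ℝ, (0 : ℝ) ∈ Z → (cellResidues p D Z).Nonempty := fun Z hZ =>
    ⟨0, by simpa [cellResidues] using ⟨0, hZ, hD, by simp⟩⟩
  have hcd := ZMod.cauchy_davenport hp (hne X hX0) (hne Y hY0)
  set P := cellResidues p D X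
  set Q := cellResidues p D Y
  have hcd' : min D ((P.card + Q.card - 1) * e) ≤ (P + Q).card * e := by
    have h1 : 1 ≤ P.card := (hne X hX0).card_pos
    have h2 : (min p (P.card + Q.card - 1) : ℝ) ≤ ((P + Q).card : ℝ) := by
      have : ((min p (P.card + Q.card - 1) : ℕ) : ℝ) ≤ ((P + Q).card : ℝ) := by exact_mod_cast hcd
      rwa [Nat.cast_min, Nat.cast_sub (by omega), Nat.cast_add, Nat.cast_one] at this
    calc min D ((P.card + Q.card - 1) * e)
        = (min p (P.card + Q.card - 1) : ℝ) * e := by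
          rw [min_mul_of_nonneg _ _ he0.le, hpe]
      _ ≤ _ := by gcongr
  -- If `x` and `y` lie in the cells `a` and `b`, then `x + y` lies in $[(a+b)e,(a+b+2)e)$, hence
  -- within `2 * e` of every point of the cell `a + b`. When `a + b ≥ p` the index wraps around and
  -- the copy shifted by `-D` takes over.
  have hcell : (P + Q).card * e ≤ μ.real (Metric.cthickening (2 * e) W) := by
    have hdisj : Set.PairwiseDisjoint ((P + Q : Finset (ZMod p)) : Set (ZMod p))
        fun k => Set.Ico ((k.val : ℝ) * e) ((k.val + 1) * e) := by
      intro i _ j _ hij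
      have hne' : i.val ≠ j.val := fun h => hij (ZMod.val_injective p h)
      refine Set.disjoint_left.2 fun z hz hz' => ?_
      have h1 := lt_of_mul_lt_mul_right (hz.1.trans_lt hz'.2) he0.le
      have h2 := lt_of_mul_lt_mul_right (hz'.1.trans_lt hz.2) he0.le
      have h3 : i.val < j.val + 1 := by exact_mod_cast h1
      have h4 : j.val < i.val + 1 := by exact_mod_cast h2
      omega
    have hvol : volume.real (⋃ k ∈ P + Q, Set.Ico ((k.val : ℝ) * e) ((k.val + 1) * e))
        = (P + Q).card * e := by
      rw [measureReal_biUnion_finset hdisj (fun _ _ => measurableSet_Ico) (fun _ _ => by simp),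
        ← nsmul_eq_mul, ← Finset.sum_const]
      refine Finset.sum_congr rfl fun i _ => ?_
      rw [Real.volume_real_Ico_of_le (by nlinarith)]
      ring
    rw [← hvol, hμr]
    refine measureReal_mono ?_
      ((measure_mono Set.inter_subset_right).trans_lt (by simp : volume (Set.Icc 0 D) < ∞)).ne
    intro z hz
    obtain ⟨k, hk, hzk⟩ := Set.mem_iUnion₂.1 hz
    obtain ⟨i, hi, j, hj, rfl⟩ := Finset.mem_add.1 hk
    simp only [P, Q, cellResidues, Finset.mem_filter, Finset.mem_univ, true_and] at hi hj
    obtain ⟨x, hx, hxD, rfl⟩ := hi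
    obtain ⟨y, hy, hyD, rfl⟩ := hj
    rw [← he] at hzk
    have hxb := floor_cell_bounds he0 (hXD hx).1
    have hyb := floor_cell_bounds he0 (hYD hy).1
    set a := ⌊x / e⌋₊
    set b := ⌊y / e⌋₊
    have hap : a < p := by
      have : (a : ℝ) * e < p * e := by linarith
      exact_mod_cast lt_of_mul_lt_mul_right this he0.le
    have hbp : b < p := by
      have : (b : ℝ) * e < p * e := by linarith
      exact_mod_cast lt_of_mul_lt_mul_right this he0.le
    have hval : ((a : ZMod p) + (b : ZMod p)).val = (a + b) % p := by
      rw [← Nat.cast_add, ZMod.val_natCast]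
    have hkp : (((a : ZMod p) + (b : ZMod p)).val : ℝ) + 1 ≤ p := by
      exact_mod_cast ZMod.val_lt _
    refine ⟨?_, (by positivity : (0 : ℝ) ≤ _).trans hzk.1, ?_⟩
    swap
    · rw [← hpe]
      exact hzk.2.le.trans (by gcongr)
    have hxyW : x + y ∈ W := Or.inl (Set.add_mem_add hx hy)
    have hxyW' : x + y + -D ∈ W := Or.inr ⟨x + y, Set.add_mem_add hx hy, rfl⟩
    rcases lt_or_ge (a + b) p with hab | hab
    · rw [hval, Nat.mod_eq_of_lt hab] at hzk
      push_cast at hzk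
      refine Metric.mem_cthickening_of_dist_le z (x + y) _ _ hxyW ?_
      rw [Real.dist_eq, abs_le]
      constructor <;> nlinarith [hzk.1, hzk.2]
    · have : (a + b) % p = a + b - p := by
        rw [Nat.mod_eq_sub_mod hab, Nat.mod_eq_of_lt (by omega)]
      rw [hval, this, Nat.cast_sub hab] at hzk
      push_cast at hzk
      refine Metric.mem_cthickening_of_dist_le z (x + y + -D) _ _ hxyW' ?_
      rw [Real.dist_eq, abs_le]
      constructor <;> nlinarith [hzk.1, hzk.2]
  have h2e := hrW (y := 2 * e) (by rw [Real.dist_eq, sub_zero, abs_of_pos (by positivity)]; exact her)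
  have hXle := measureReal_le_card_cellResidues (p := p) hD hXD
  have hYle := measureReal_le_card_cellResidues (p := p) hD hYD
  -- The `-1` of Cauchy-Davenport costs one cell, which is the second half of `η`.
  have : min D (volume.real X + volume.real Y) ≤ min D ((P.card + Q.card - 1) * e) + e := by
    rw [← min_add_add_right]
    refine min_le_min (by linarith) ?_
    calc volume.real X + volume.real Y ≤ P.card * e + Q.card * e := add_le_add hXle hYle
      _ = _ := by ring
  linarith

/-- Fold `X + Y` modulo `D` into the pieces `U` and `V`. Their union is the sumset on the circle, of
measure at least $\min(D,|X|+|Y|)$; their intersection contains `Y`, because both `0` and `D` belong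
to `X`. Then $|X+Y|\ge|U|+|V|=|U\cup V|+|U\cap V|$. -/
theorem freiman_normalized {X Y : Set ℝ} {D : ℝ} (hX : IsCompact X)
    (hY : IsCompact Y) (hXD : X ⊆ Set.Icc 0 D) (hYD : Y ⊆ Set.Icc 0 D) (hX0 : (0 : ℝ) ∈ X)
    (hDX : D ∈ X) (hY0 : (0 : ℝ) ∈ Y) :
    min (D + volume.real Y) (volume.real X + 2 * volume.real Y) ≤ volume.real (X + Y) := by
  have hXY := hX.add hY
  rcases (hXD hX0).2.eq_or_lt with rfl | hD
  · refine (min_le_left _ _).trans ?_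
    rw [zero_add]
    exact measureReal_mono (fun y hy => ⟨0, hX0, y, hy, zero_add y⟩) hXY.measure_ne_top
  have hcirc := min_le_measureReal_add_mod hD hX hY hXD hYD hX0 hY0
  set W := X + Y with hW
  have hWD : W ⊆ Set.Icc 0 (D + D) := by
    rintro _ ⟨x, hx, y, hy, rfl⟩
    exact ⟨add_nonneg (hXD hx).1 (hYD hy).1, add_le_add (hXD hx).2 (hYD hy).2⟩
  set U := W ∩ Set.Icc 0 D with hU
  set V := (fun x => x + (-D)) '' (W ∩ Set.Icc D (D + D)) with hV
  have hUc : IsCompact U := hXY.inter_right isClosed_Icc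
  have hVc : IsCompact V := (hXY.inter_right isClosed_Icc).image (by fun_prop)
  have hUV : (W ∪ (fun x => x + (-D)) '' W) ∩ Set.Icc 0 D ⊆ U ∪ V := by
    rintro z ⟨hz | ⟨w, hw, rfl⟩, hzD⟩
    · exact Or.inl ⟨hz, hzD⟩
    · refine Or.inr ⟨w, ⟨hw, ?_, (hWD hw).2⟩, rfl⟩
      have := hzD.1
      simp only at this
      linarith
  have hYUV : Y ⊆ U ∩ V := by
    intro y hy
    refine ⟨⟨⟨0, hX0, y, hy, zero_add y⟩, hYD hy⟩, D + y, ⟨⟨D, hDX, y, hy, rfl⟩, ?_, ?_⟩, by simp⟩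
    · linarith [(hYD hy).1]
    · linarith [(hYD hy).2]
  have h1 := measureReal_union_add_inter (μ := volume) (s := U) hVc.measurableSet
    hUc.measure_ne_top hVc.measure_ne_top
  have h2 := measureReal_mono (μ := volume) hUV (hUc.union hVc).measure_ne_top
  have h3 := measureReal_mono (μ := volume) hYUV
    ((measure_mono Set.inter_subset_left).trans_lt hUc.measure_lt_top).ne
  have h4 : volume.real U + volume.real V ≤ volume.real W := by
    have hV' : volume.real V = volume.real (W ∩ Set.Icc D (D + D)) :=
      Real.volume_real_image_add_const _ _
    have hc : IsCompact (W ∩ Set.Icc D (D + D)) := hXY.inter_right isClosed_Icc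
    have h5 := measureReal_union_add_inter (μ := volume) (s := U) hc.measurableSet
      hUc.measure_ne_top hc.measure_ne_top
    have h6 : volume.real (U ∩ (W ∩ Set.Icc D (D + D))) = 0 :=
      measureReal_mono_null (s₂ := {D}) (fun z hz => le_antisymm hz.1.2.2 hz.2.2.1)
        (by simp [measureReal_def]) (by simp)
    have h7 := measureReal_mono (μ := volume)
      (Set.union_subset (Set.inter_subset_left : U ⊆ W)
        (Set.inter_subset_left : W ∩ Set.Icc D (D + D) ⊆ W)) hXY.measure_ne_top
    rw [hV']
    linarith
  have h8 : min (D + volume.real Y) (volume.real X + 2 * volume.real Y) =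
      min D (volume.real X + volume.real Y) + volume.real Y := by
    rw [← min_add_add_right]
    congr 1
    ring
  rw [h8]
  linarith

theorem measureReal_image_add_add_image_add (X Y : Set ℝ) (c d : ℝ) :
    volume.real ((fun x => x + c) '' X + (fun y => y + d) '' Y) = volume.real (X + Y) := by
  rw [← Real.volume_real_image_add_const (c + d) (X + Y)]
  congr 1
  ext z
  constructor
  · rintro ⟨_, ⟨x, hx, rfl⟩, _, ⟨y, hy, rfl⟩, rfl⟩
    exact ⟨x + y, Set.add_mem_add hx hy, by ring⟩
  · rintro ⟨_, ⟨x, hx, y, hy, rfl⟩, rfl⟩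
    exact ⟨x + c, ⟨x, hx, rfl⟩, y + d, ⟨y, hy, rfl⟩, by ring⟩

/-- Freiman's inequality on the line, for the summand of larger diameter. -/
theorem freiman_inequality {X Y : Set ℝ} (hX : IsCompact X) (hY : IsCompact Y)
    (hX0 : X.Nonempty) (hY0 : Y.Nonempty) (hd : sSup Y - sInf Y ≤ sSup X - sInf X) :
    min (sSup X - sInf X + volume.real Y) (volume.real X + 2 * volume.real Y) ≤
      volume.real (X + Y) := by
  have hx0 := hX.sInf_mem hX0
  have hx1 := hX.sSup_mem hX0
  have hy0 := hY.sInf_mem hY0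
  have h := freiman_normalized (X := (fun x => x + (-sInf X)) '' X)
    (Y := (fun x => x + (-sInf Y)) '' Y) (D := sSup X - sInf X)
    (hX.image (by fun_prop)) (hY.image (by fun_prop)) ?_ ?_ ⟨_, hx0, by simp⟩
    ⟨_, hx1, by simp [sub_eq_add_neg]⟩ ⟨_, hy0, by simp⟩
  · rwa [measureReal_image_add_add_image_add, Real.volume_real_image_add_const,
      Real.volume_real_image_add_const] at h
  · rintro _ ⟨x, hx, rfl⟩
    have h1 : x ≤ sSup X := le_csSup hX.bddAbove hx
    have h2 : sInf X ≤ x := csInf_le hX.bddBelow hx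
    constructor <;> simp only <;> linarith
  · rintro _ ⟨x, hx, rfl⟩
    have h1 : x ≤ sSup Y := le_csSup hY.bddAbove hx
    have h2 : sInf Y ≤ x := csInf_le hY.bddBelow hx
    constructor <;> simp only <;> linarith

/-! ### Stability of Brunn-Minkowski on the line. -/

/-- Up to measure `2ζ`, the set `X` lies in an interval of length at most `|X| + ζ`. -/
def NearInterval (X : Set ℝ) (ζ : ℝ) : Prop :=
  ∃ p q : ℝ, p ≤ q ∧ q - p ≤ volume.real X + ζ ∧ volume.real (X \ Set.Icc p q) ≤ 2 * ζ

theorem nearInterval_of_measureReal_le {X : Set ℝ} {ζ : ℝ} (hX : volume.real X ≤ 2 * ζ)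
    (hfin : volume X ≠ ∞) (hζ : 0 ≤ ζ) :
    NearInterval X ζ :=
  ⟨0, 0, le_rfl, by simpa using add_nonneg measureReal_nonneg hζ,
    (measureReal_mono Set.sdiff_subset hfin).trans hX⟩

theorem NearInterval.mono {X : Set ℝ} {ζ ξ : ℝ} (h : NearInterval X ζ) (hζ : ζ ≤ ξ) :
    NearInterval X ξ := by
  obtain ⟨p, q, h1, h2, h3⟩ := h
  exact ⟨p, q, h1, by linarith, by linarith⟩

theorem exists_measureReal_inter_Iic_eq {X : Set ℝ} (hX : IsCompact X) {c : ℝ} (hc0 : 0 ≤ c)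
    (hc : c ≤ volume.real X) : ∃ x, volume.real (X ∩ Set.Iic x) = c := by
  rcases X.eq_empty_or_nonempty with rfl | hX0
  · exact ⟨0, by simp at hc ⊢; linarith⟩
  set F : ℝ → ℝ := fun x => volume.real (X ∩ Set.Iic x) with hF
  have hfin : ∀ S : Set ℝ, volume (X ∩ S) ≠ ∞ := fun S =>
    ((measure_mono Set.inter_subset_left).trans_lt hX.measure_lt_top).ne
  have hmono : ∀ x y, x ≤ y → F y ≤ F x + (y - x) := by
    intro x y hxy
    have hsub : X ∩ Set.Iic y ⊆ (X ∩ Set.Iic x) ∪ Set.Ioc x y := by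
      rintro z ⟨hz, hzy⟩
      rcases le_or_gt z x with h | h
      · exact Or.inl ⟨hz, h⟩
      · exact Or.inr ⟨h, hzy⟩
    calc F y ≤ volume.real ((X ∩ Set.Iic x) ∪ Set.Ioc x y) :=
          measureReal_mono hsub (measure_union_lt_top (hfin _).lt_top (by simp)).ne
      _ ≤ F x + volume.real (Set.Ioc x y) := measureReal_union_le _ _
      _ = F x + (y - x) := by rw [Real.volume_real_Ioc_of_le hxy]
  have hcont : Continuous F := by
    refine (LipschitzWith.of_le_add_mul 1 fun x y => ?_).continuous
    rw [NNReal.coe_one, one_mul, Real.dist_eq]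
    rcases le_total x y with h | h
    · have : F x ≤ F y := measureReal_mono
        (Set.inter_subset_inter_right _ (Set.Iic_subset_Iic.2 h)) (hfin _)
      linarith [abs_nonneg (x - y)]
    · linarith [hmono y x h, le_abs_self (x - y)]
  have h0 : F (sInf X) ≤ c := by
    have : F (sInf X) = 0 := measureReal_mono_null (s₂ := {sInf X})
      (fun z hz => le_antisymm hz.2 (csInf_le hX.bddBelow hz.1)) (by simp [measureReal_def])
      (by simp)
    rwa [this]
  have h1 : c ≤ F (sSup X) := by
    have : X ∩ Set.Iic (sSup X) = X :=
      Set.inter_eq_left.2 fun z hz => le_csSup hX.bddAbove hz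
    simpa only [hF, this] using hc
  obtain ⟨x, -, hx⟩ := intermediate_value_Icc
    (csInf_le hX.bddBelow (hX.sSup_mem hX0)) hcont.continuousOn ⟨h0, h1⟩
  exact ⟨x, hx⟩

/-- Near equality in the one-dimensional Brunn-Minkowski inequality forces each summand to be close
to an interval. -/
theorem nearInterval_of_measureReal_add_lt {X Y : Set ℝ} {ζ : ℝ} (hX : IsCompact X)
    (hY : IsCompact Y) (hζ : 0 < ζ) (hXζ : ζ ≤ volume.real X) (hYζ : ζ ≤ volume.real Y)
    (hXY : volume.real (X + Y) < volume.real X + volume.real Y + ζ) : NearInterval X ζ := by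
  have hne : ∀ Z : Set ℝ, ζ ≤ volume.real Z → Z.Nonempty := fun Z hZ =>
    nonempty_of_measureReal_ne_zero (hζ.trans_le hZ).ne'
  have hX0 := hne X hXζ
  have hY0 := hne Y hYζ
  have hXle := csInf_le hX.bddBelow (hX.sSup_mem hX0)
  have hYle := csInf_le hY.bddBelow (hY.sSup_mem hY0)
  have hXI : X ⊆ Set.Icc (sInf X) (sSup X) := fun x hx =>
    ⟨csInf_le hX.bddBelow hx, le_csSup hX.bddAbove hx⟩
  have hYI : Y ⊆ Set.Icc (sInf Y) (sSup Y) := fun x hx =>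
    ⟨csInf_le hY.bddBelow hx, le_csSup hY.bddAbove hx⟩
  -- If `X` has the larger diameter, Freiman's inequality bounds that diameter directly; its other
  -- alternative would give $|Y|<\zeta$.
  rcases le_or_gt (sSup Y - sInf Y) (sSup X - sInf X) with hd | hd
  · have h := freiman_inequality hX hY hX0 hY0 hd
    refine ⟨sInf X, sSup X, hXle, ?_, ?_⟩
    · rcases min_le_iff.1 h with h | h <;> linarith
    · rw [Set.sdiff_eq_empty.2 hXI]
      simp [hζ.le]
  -- Here `Y` has the larger diameter and only `Y` is seen to fill its hull up to `ζ`. Since `X` may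
  -- have remote points, mass `ζ` is cut off at each end, at `x1` and `x2`.
  have h := freiman_inequality hY hX hY0 hX0 hd.le
  rw [add_comm Y X] at h
  have hYd : sSup Y - sInf Y < volume.real Y + ζ := by
    rcases min_le_iff.1 h with h | h <;> linarith
  rcases le_or_gt (volume.real X) (2 * ζ) with h2 | h2
  · exact nearInterval_of_measureReal_le h2 hX.measure_ne_top hζ.le
  have hfin : ∀ S : Set ℝ, volume (X ∩ S) ≠ ∞ := fun S =>
    ((measure_mono Set.inter_subset_left).trans_lt hX.measure_lt_top).ne
  obtain ⟨x1, hx1⟩ := exists_measureReal_inter_Iic_eq hX hζ.le hXζ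
  obtain ⟨x2, hx2⟩ := exists_measureReal_inter_Iic_eq hX (c := volume.real X - ζ) (by linarith)
    (by linarith)
  have hx12 : x1 ≤ x2 := by
    by_contra! hlt
    have : volume.real (X ∩ Set.Iic x2) ≤ volume.real (X ∩ Set.Iic x1) := measureReal_mono
      (Set.inter_subset_inter_right _ (Set.Iic_subset_Iic.2 hlt.le)) (hfin _)
    linarith
  have hx2' : volume.real (X \ Set.Iic x2) = ζ := by
    have := measureReal_inter_add_sdiff (μ := volume) (s := X) (measurableSet_Iic (a := x2))
      hX.measure_ne_top
    linarith
  -- For `z` in this interval, $X\cap(z-\mathrm{hull}\,Y)$ contains one of the two ends of `X` and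
  -- so has measure at least `ζ`, while the gaps of `Y` have measure less than `ζ`. Hence some `z -
  -- x` lies in `Y`. The length of the interval then bounds `x2 - x1`.
  have hsum : Set.Icc (sInf Y + x1) (sSup Y + x2) ⊆ X + Y := by
    rintro z ⟨hz1, hz2⟩
    have hbig : ζ ≤ volume.real (X ∩ Set.Icc (z - sSup Y) (z - sInf Y)) := by
      rcases le_or_gt (z - sSup Y) (sInf X) with hc | hc
      · rw [← hx1]
        refine measureReal_mono ?_ (hfin _)
        rintro x ⟨hx, hxx⟩
        have := (hXI hx).1
        exact ⟨hx, by linarith, by linarith [Set.mem_Iic.1 hxx]⟩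
      -- The upper end of `X` stays below `z - sInf Y` because the diameter of `X` is smaller than
      -- that of `Y`.
      · rw [← hx2']
        refine measureReal_mono ?_ (hfin _)
        rintro x ⟨hx, hxx⟩
        have := (hXI hx).2
        have := not_le.1 (show ¬ x ≤ x2 from hxx)
        exact ⟨hx, by linarith, by linarith⟩
    have hgap : volume.real (Set.Icc (sInf Y) (sSup Y) \ Y) < ζ := by
      rw [measureReal_sdiff hYI hY.measurableSet (by simp), Real.volume_real_Icc_of_le hYle]
      linarith
    set Z := X ∩ Set.Icc (z - sSup Y) (z - sInf Y) with hZ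
    have hZc : volume.real ((fun x => z - x) '' Z) = volume.real Z := by
      have : (fun x => z - x) '' Z = (fun x => z - x) ⁻¹' Z := by
        ext w
        constructor
        · rintro ⟨x, hx, rfl⟩
          simpa using hx
        · intro hw
          exact ⟨z - w, hw, by simp⟩
      rw [this, measureReal_def, (Measure.measurePreserving_sub_left volume z).measure_preimage]
      · rfl
      · exact (hX.measurableSet.inter measurableSet_Icc).nullMeasurableSet
    by_contra hnot
    have hsub : (fun x => z - x) '' Z ⊆ Set.Icc (sInf Y) (sSup Y) \ Y := by
      rintro _ ⟨x, ⟨hx, hx1, hx2⟩, rfl⟩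
      refine ⟨⟨by linarith, by linarith⟩, fun hy => hnot ⟨x, hx, _, hy, ?_⟩⟩
      simp
    have := measureReal_mono (μ := volume) hsub
      ((measure_mono Set.sdiff_subset).trans_lt (by simp : volume (Set.Icc (sInf Y) (sSup Y)) < ∞)).ne
    linarith
  have hlen := measureReal_mono (μ := volume) hsum (hX.add hY).measure_ne_top
  rw [Real.volume_real_Icc_of_le (by linarith)] at hlen
  refine ⟨x1, x2, hx12, ?_, ?_⟩
  · have := measureReal_mono (μ := volume) hYI (by simp)
    rw [Real.volume_real_Icc_of_le hYle] at this
    linarith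
  · have hsub : X \ Set.Icc x1 x2 ⊆ (X ∩ Set.Iic x1) ∪ (X \ Set.Iic x2) := by
      rintro x ⟨hx, hxI⟩
      by_cases h1 : x ≤ x1
      · exact Or.inl ⟨hx, h1⟩
      · exact Or.inr ⟨hx, fun h2 => hxI ⟨(not_le.1 h1).le, h2⟩⟩
    have hf2 : volume (X \ Set.Iic x2) ≠ ∞ :=
      ((measure_mono Set.sdiff_subset).trans_lt hX.measure_lt_top).ne
    have := (measureReal_mono (μ := volume) hsub
      (measure_union_lt_top (hfin _).lt_top hf2.lt_top).ne).trans (measureReal_union_le _ _)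
    linarith

/-! ### Integrals compared through superlevel sets at proportional heights. -/

theorem lintegral_ofReal_div_eq {f : ℝ → ℝ} {a : ℝ} (hf : Measurable f) (hf0 : ∀ x, 0 ≤ f x)
    (ha : 0 < a) :
    ∫⁻ x, ENNReal.ofReal (f x) =
      ENNReal.ofReal a * ∫⁻ s in Set.Ioi 0, volume {x | a * s ≤ f x} := by
  have h := lintegral_eq_lintegral_meas_le (μ := volume) (f := fun x => f x / a)
    (Eventually.of_forall fun x => div_nonneg (hf0 x) ha.le) (hf.div_const a).aemeasurable
  have h2 : ∀ s, {x | s ≤ f x / a} = {x | a * s ≤ f x} := fun s => by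
    ext x
    simp only [Set.mem_ofPred_eq]
    rw [le_div_iff₀ ha, mul_comm]
  simp only [h2] at h
  rw [← h, ← lintegral_const_mul _ (by fun_prop)]
  refine lintegral_congr fun x => ?_
  rw [← ENNReal.ofReal_mul ha.le]
  congr 1
  field_simp

theorem lintegral_superlevel_eq {f : ℝ → ℝ} {a : ℝ} (ha : 0 < a) (hfa : ∀ x, f x ≤ a) :
    ∫⁻ s in Set.Ioi 0, volume {x | a * s ≤ f x} =
      ∫⁻ s in Set.Ioo 0 1, volume {x | a * s ≤ f x} := by
  rw [setLIntegral_congr (Ioo_ae_eq_Ioc (a := (0 : ℝ)) (b := 1)),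
    ← Set.Ioc_union_Ioi_eq_Ioi zero_le_one, lintegral_union measurableSet_Ioi Set.Ioc_disjoint_Ioi_same]
  convert add_zero _ using 2
  rw [setLIntegral_eq_zero measurableSet_Ioi]
  intro s hs
  have : {x | a * s ≤ f x} = ∅ := by
    ext x
    simp only [Set.mem_ofPred_eq, Set.mem_empty_iff_false, iff_false, not_le]
    have := hfa x
    have : (1 : ℝ) < s := hs
    nlinarith
  simp [this]

/-- Comparison of integrals through superlevel sets at proportional heights, with a gain `γ` at the
levels below `s0`. -/
theorem lintegral_ge_of_superlevel {f g h : ℝ → ℝ} {a b γ s0 : ℝ} (hf : Measurable f)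
    (hg : Measurable g) (hh : Measurable h) (hf0 : ∀ x, 0 ≤ f x) (hg0 : ∀ x, 0 ≤ g x)
    (hh0 : ∀ x, 0 ≤ h x) (ha : 0 < a) (hb : 0 < b) (hfa : ∀ x, f x ≤ a) (hgb : ∀ x, g x ≤ b)
    (hs1 : s0 ≤ 1)
    (H : ∀ s ∈ Set.Ioo (0 : ℝ) 1, volume {x | a * s ≤ f x} + volume {x | b * s ≤ g x} +
      (Set.Ioo 0 s0).indicator (fun _ => ENNReal.ofReal γ) s ≤ volume {x | (a + b) * s ≤ h x})
    {F G : ℝ} (hF0 : 0 ≤ F) (hG0 : 0 ≤ G)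
    (hF : ∫⁻ x, ENNReal.ofReal (f x) = ENNReal.ofReal F)
    (hG : ∫⁻ x, ENNReal.ofReal (g x) = ENNReal.ofReal G) (hγ : 0 ≤ γ) (hs0 : 0 ≤ s0) :
    ENNReal.ofReal ((a + b) * (F / a + G / b + γ * s0)) ≤ ∫⁻ x, ENNReal.ofReal (h x) := by
  have key : ∀ {f : ℝ → ℝ} {a F : ℝ}, Measurable f → (∀ x, 0 ≤ f x) → 0 < a → (∀ x, f x ≤ a) →
      ∫⁻ x, ENNReal.ofReal (f x) = ENNReal.ofReal F → 
      ∫⁻ s in Set.Ioo 0 1, volume {x | a * s ≤ f x} = ENNReal.ofReal (F / a) := by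
    intro f a F hf hf0 ha hfa hF
    rw [← lintegral_superlevel_eq ha hfa, ENNReal.ofReal_div_of_pos ha, ← hF,
      lintegral_ofReal_div_eq hf hf0 ha, mul_comm, ENNReal.mul_div_cancel_right (by simpa using ha)
        ENNReal.ofReal_ne_top]
  have hanti : ∀ (f : ℝ → ℝ) {a : ℝ}, 0 < a → Measurable fun s => volume {x | a * s ≤ f x} := by
    intro f a ha
    refine Antitone.measurable fun s s' hss => measure_mono fun x hx => ?_
    exact (mul_le_mul_of_nonneg_left hss ha.le).trans hx
  rw [lintegral_ofReal_div_eq hh hh0 (by positivity : 0 < a + b), ENNReal.ofReal_mul (by positivity)]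
  gcongr
  have hgain : ∫⁻ s in Set.Ioo (0 : ℝ) 1, (Set.Ioo 0 s0).indicator (fun _ => ENNReal.ofReal γ) s =
      ENNReal.ofReal (γ * s0) := by
    rw [lintegral_indicator measurableSet_Ioo, Measure.restrict_restrict measurableSet_Ioo,
      setLIntegral_const, Set.inter_eq_left.2 (Set.Ioo_subset_Ioo_right hs1), Real.volume_Ioo,
      sub_zero, ENNReal.ofReal_mul hγ]
  calc ENNReal.ofReal (F / a + G / b + γ * s0)
      = ∫⁻ s in Set.Ioo (0 : ℝ) 1, (volume {x | a * s ≤ f x} + volume {x | b * s ≤ g x} +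
          (Set.Ioo 0 s0).indicator (fun _ => ENNReal.ofReal γ) s) := by
        rw [lintegral_add_left (f := fun s => volume {x | a * s ≤ f x} + volume {x | b * s ≤ g x})
          ((hanti f ha).add (hanti g hb)), lintegral_add_left (hanti f ha),
          key hf hf0 ha hfa hF, key hg hg0 hb hgb hG, hgain,
          ENNReal.ofReal_add (by positivity) (by positivity),
          ENNReal.ofReal_add (by positivity) (by positivity)]
    _ ≤ ∫⁻ s in Set.Ioo (0 : ℝ) 1, volume {x | (a + b) * s ≤ h x} :=
        setLIntegral_mono' measurableSet_Ioo H
    _ ≤ ∫⁻ s in Set.Ioi (0 : ℝ), volume {x | (a + b) * s ≤ h x} :=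
        lintegral_mono_set Set.Ioo_subset_Ioi_self

/-- Cauchy-Schwarz: the difference of the two sides is $(b\sqrt F-a\sqrt G)^2/(ab)$. -/
theorem sq_sqrt_add_sqrt_le {F G a b : ℝ} (hF : 0 ≤ F) (hG : 0 ≤ G) (ha : 0 < a) (hb : 0 < b) :
    (√F + √G) ^ 2 ≤ (a + b) * (F / a + G / b) := by
  have h1 : (√F + √G) ^ 2 = F + G + 2 * (√F * √G) := by
    nlinarith [Real.sq_sqrt hF, Real.sq_sqrt hG]
  have h2 : (a + b) * (F / a + G / b) = F + G + (b * F / a + a * G / b) := by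
    field_simp
    ring
  have h3 : 2 * (√F * √G) ≤ b * F / a + a * G / b := by
    have e : b * F / a + a * G / b - 2 * (√F * √G) = (b * √F - a * √G) ^ 2 / (a * b) := by
      field_simp
      ring_nf
      rw [Real.sq_sqrt hF, Real.sq_sqrt hG]
    have : 0 ≤ (b * √F - a * √G) ^ 2 / (a * b) := by positivity
    linarith
  linarith

/-! ### Vertical slices of compact planar sets. -/

/-- The vertical slice of a planar set over the abscissa `x`. -/
def slice (A : Set (ℝ × ℝ)) (x : ℝ) : Set ℝ := Prod.mk x ⁻¹' A

theorem mem_slice {A : Set (ℝ × ℝ)} {x y : ℝ} : y ∈ slice A x ↔ (x, y) ∈ A := Iff.rfl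

theorem slice_subset_image_snd (A : Set (ℝ × ℝ)) (x : ℝ) : slice A x ⊆ Prod.snd '' A :=
  fun _ hy => ⟨_, hy, rfl⟩

theorem slice_add_subset (A B : Set (ℝ × ℝ)) (x y : ℝ) :
    slice A x + slice B y ⊆ slice (A + B) (x + y) := by
  rintro _ ⟨u, hu, v, hv, rfl⟩
  exact ⟨(x, u), hu, (y, v), hv, rfl⟩

theorem IsCompact.slice {A : Set (ℝ × ℝ)} (hA : IsCompact A) (x : ℝ) : IsCompact (slice A x) :=
  (hA.image continuous_snd).of_isClosed_subset (hA.isClosed.preimage (by fun_prop))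
    (slice_subset_image_snd A x)

theorem measurable_measureReal_slice {A : Set (ℝ × ℝ)} (hA : MeasurableSet A) :
    Measurable fun x => volume.real (slice A x) :=
  (measurable_measure_prodMk_left hA).ennreal_toReal

theorem lintegral_measureReal_slice {A : Set (ℝ × ℝ)} (hA : IsCompact A) :
    ∫⁻ x, ENNReal.ofReal (volume.real (slice A x)) = ENNReal.ofReal (volume.real A) := by
  rw [ofReal_measureReal hA.measure_ne_top, Measure.volume_eq_prod,
    Measure.prod_apply hA.measurableSet]
  exact lintegral_congr fun x => ofReal_measureReal (hA.slice x).measure_ne_top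

/-- The supremum of the lengths of the vertical slices. -/
noncomputable def sliceSup (A : Set (ℝ × ℝ)) : ℝ := ⨆ x, volume.real (slice A x)

theorem IsCompact.measureReal_slice_le_image {A : Set (ℝ × ℝ)} (hA : IsCompact A) (x : ℝ) :
    volume.real (_root_.slice A x) ≤ volume.real (Prod.snd '' A) :=
  measureReal_mono (slice_subset_image_snd A x) (hA.image continuous_snd).measure_ne_top

theorem IsCompact.measureReal_slice_le {A : Set (ℝ × ℝ)} (hA : IsCompact A) (x : ℝ) :
    volume.real (_root_.slice A x) ≤ sliceSup A :=
  le_ciSup (f := fun x => volume.real (_root_.slice A x))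
    ⟨_, Set.forall_mem_range.2 hA.measureReal_slice_le_image⟩ x

theorem IsCompact.sliceSup_le {A : Set (ℝ × ℝ)} (hA : IsCompact A) :
    sliceSup A ≤ volume.real (Prod.snd '' A) :=
  ciSup_le hA.measureReal_slice_le_image

theorem exists_lt_measureReal_slice {A : Set (ℝ × ℝ)} {c : ℝ} (hc : c < sliceSup A) :
    ∃ x, c < volume.real (slice A x) :=
  exists_lt_of_lt_ciSup hc

/-- The slice length is upper semicontinuous: by compactness, an open set around one slice contains
all slices over nearby abscissae. -/
theorem isClosed_superlevel_slice {A : Set (ℝ × ℝ)} (hA : IsCompact A) (c : ℝ) :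
    IsClosed {x | c ≤ volume.real (slice A x)} := by
  rw [← isOpen_compl_iff, isOpen_iff_mem_nhds]
  intro x hx
  have hx : volume.real (slice A x) < c := not_le.1 hx
  have hc : 0 < c := measureReal_nonneg.trans_lt hx
  have hlt : volume (slice A x) < ENNReal.ofReal c := by
    rw [← ofReal_measureReal (hA.slice x).measure_ne_top]
    exact (ENNReal.ofReal_lt_ofReal_iff hc).2 hx
  obtain ⟨U, hU, hUo, hUc⟩ := (slice A x).exists_isOpen_lt_of_lt _ hlt
  have hK : IsCompact (Prod.fst '' (A ∩ Prod.snd ⁻¹' Uᶜ)) :=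
    (hA.inter_right (hUo.isClosed_compl.preimage continuous_snd)).image continuous_fst
  refine mem_of_superset (hK.isClosed.isOpen_compl.mem_nhds ?_) fun x' hx' =>
    show ¬ c ≤ volume.real (slice A x') from not_le.2 ?_
  · rintro ⟨⟨x'', y⟩, ⟨h1, h2⟩, rfl⟩
    exact h2 (hU h1)
  · have hsub : slice A x' ⊆ U := by
      intro y hy
      by_contra hyU
      exact hx' ⟨(x', y), ⟨hy, hyU⟩, rfl⟩
    rw [← ENNReal.ofReal_lt_ofReal_iff hc, ofReal_measureReal (hA.slice x').measure_ne_top]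
    exact (measure_mono hsub).trans_lt hUc

theorem superlevel_slice_subset {A : Set (ℝ × ℝ)} {c : ℝ} (hc : 0 < c) :
    {x | c ≤ volume.real (slice A x)} ⊆ Prod.fst '' A := by
  intro x hx
  obtain ⟨y, hy⟩ := nonempty_of_measureReal_ne_zero (hc.trans_le hx).ne'
  exact ⟨(x, y), hy, rfl⟩

theorem isCompact_superlevel_slice {A : Set (ℝ × ℝ)} (hA : IsCompact A) {c : ℝ} (hc : 0 < c) :
    IsCompact {x | c ≤ volume.real (slice A x)} :=
  (hA.image continuous_fst).of_isClosed_subset (isClosed_superlevel_slice hA c)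
    (superlevel_slice_subset hc)

theorem measureReal_inter_preimage_fst_le {A : Set (ℝ × ℝ)} (hA : IsCompact A) {Z : Set ℝ}
    (hZ : MeasurableSet Z) (hZfin : volume Z ≠ ∞) {c : ℝ} (hc : 0 ≤ c)
    (h : ∀ x ∈ Z, volume.real (slice A x) ≤ c) :
    volume.real (A ∩ Prod.fst ⁻¹' Z) ≤ c * volume.real Z := by
  have hm : MeasurableSet (A ∩ Prod.fst ⁻¹' Z) := hA.measurableSet.inter (measurable_fst hZ)
  refine ENNReal.toReal_le_of_le_ofReal (mul_nonneg hc measureReal_nonneg) ?_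
  rw [Measure.volume_eq_prod, Measure.prod_apply hm, ENNReal.ofReal_mul hc,
    ofReal_measureReal hZfin, ← lintegral_indicator_const hZ]
  refine lintegral_mono fun x => ?_
  by_cases hx : x ∈ Z
  · rw [Set.indicator_of_mem hx]
    refine (measure_mono (t := slice A x) fun y hy => hy.1).trans ?_
    rw [← ofReal_measureReal (hA.slice x).measure_ne_top]
    exact ENNReal.ofReal_le_ofReal (h x hx)
  · rw [Set.indicator_of_notMem hx]
    refine le_of_eq ((measure_mono_null (t := ∅) (fun y hy => hx hy.2) (by simp)))

theorem le_measureReal_of_le_slice {A : Set (ℝ × ℝ)} (hA : IsCompact A) {Z : Set ℝ}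
    (hZ : MeasurableSet Z) (hZfin : volume Z ≠ ∞) {c : ℝ} (hc : 0 ≤ c)
    (h : ∀ x ∈ Z, c ≤ volume.real (slice A x)) : c * volume.real Z ≤ volume.real A := by
  rw [← ENNReal.ofReal_le_ofReal_iff measureReal_nonneg, ← lintegral_measureReal_slice hA,
    ENNReal.ofReal_mul hc, ofReal_measureReal hZfin, ← lintegral_indicator_const hZ]
  refine lintegral_mono fun x => ?_
  by_cases hx : x ∈ Z
  · rw [Set.indicator_of_mem hx]
    exact ENNReal.ofReal_le_ofReal (h x hx)
  · simp [Set.indicator_of_notMem hx]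

theorem measureReal_le_sliceSup_mul {A : Set (ℝ × ℝ)} (hA : IsCompact A) :
    volume.real A ≤ sliceSup A * volume.real (Prod.fst '' A) := by
  have hc := hA.image continuous_fst
  have h := measureReal_inter_preimage_fst_le hA hc.measurableSet hc.measure_ne_top
    (measureReal_nonneg.trans (hA.measureReal_slice_le 0)) fun x _ => hA.measureReal_slice_le x
  rwa [Set.inter_eq_left.2 (Set.subset_preimage_image _ _)] at h

/-- Over `x + y`, for each `x` in the projection of `A`, the sumset contains a translate of the
slice of `B` over `y`. -/
theorem sliceSup_mul_measureReal_le {A B : Set (ℝ × ℝ)} (hA : IsCompact A) (hB : IsCompact B) :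
    sliceSup B * volume.real (Prod.fst '' A) ≤ volume.real (A + B) := by
  have key : ∀ y, volume.real (slice B y) * volume.real (Prod.fst '' A) ≤ volume.real (A + B) := by
    intro y
    rcases (slice B y).eq_empty_or_nonempty with h0 | ⟨v, hv⟩
    · simp [h0]
    have hc : IsCompact ((fun x => x + y) '' (Prod.fst '' A)) :=
      (hA.image continuous_fst).image (by fun_prop)
    rw [← Real.volume_real_image_add_const y (Prod.fst '' A)]
    refine le_measureReal_of_le_slice (hA.add hB) hc.measurableSet hc.measure_ne_top
      measureReal_nonneg ?_
    rintro _ ⟨_, ⟨⟨x, u⟩, hxu, rfl⟩, rfl⟩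
    rw [← Real.volume_real_image_add_const u (slice B y)]
    refine measureReal_mono ?_ ((hA.add hB).slice _).measure_ne_top
    rintro _ ⟨w, hw, rfl⟩
    exact slice_add_subset A B x y ⟨u, hxu, w, hw, add_comm _ _⟩
  rcases measureReal_nonneg.eq_or_lt' (a := volume.real (Prod.fst '' A)) with h0 | h0
  · rw [h0]
    simp
  · rw [← le_div_iff₀ h0]
    exact ciSup_le fun y => (le_div_iff₀ h0).2 (key y)

/-! ### Near equality in the plane: localization and slices. -/

/-- Two compact planar sets of measure at least `m`, whose sumset has measure at most `M`, and for
which equality in the Brunn-Minkowski inequality fails by at most `δ`. -/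
structure NearEquality (m M δ : ℝ) (A B : Set (ℝ × ℝ)) : Prop where
  left_compact : IsCompact A
  right_compact : IsCompact B
  le_left : m ≤ volume.real A
  le_right : m ≤ volume.real B
  add_le : volume.real (A + B) ≤ M
  deficit : volume.real (A + B) ≤ (√(volume.real A) + √(volume.real B)) ^ 2 + δ

namespace NearEquality

variable {m M δ : ℝ} {A B : Set (ℝ × ℝ)}

theorem symm (h : NearEquality m M δ A B) : NearEquality m M δ B A where
  left_compact := h.right_compact
  right_compact := h.left_compact
  le_left := h.le_right
  le_right := h.le_left
  add_le := by rw [add_comm]; exact h.add_le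
  deficit := by rw [add_comm B A, add_comm √_]; exact h.deficit

theorem mono {δ' : ℝ} (h : NearEquality m M δ A B) (hδ : δ ≤ δ') : NearEquality m M δ' A B :=
  { h with deficit := h.deficit.trans (by linarith) }

theorem right_nonempty (h : NearEquality m M δ A B) (hm : 0 < m) : B.Nonempty :=
  nonempty_of_measureReal_ne_zero (hm.trans_le h.le_right).ne'

theorem left_le (h : NearEquality m M δ A B) (hm : 0 < m) : volume.real A ≤ M := by
  obtain ⟨b, hb⟩ := h.right_nonempty hm
  have hvol : volume.real ((fun x => x + b) '' A) = volume.real A := by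
    simp [measureReal_def]
  rw [← hvol]
  refine (measureReal_mono ?_ (h.left_compact.add h.right_compact).measure_ne_top).trans h.add_le
  rintro _ ⟨x, hx, rfl⟩
  exact Set.add_mem_add hx hb

theorem le_bound (h : NearEquality m M δ A B) (hm : 0 < m) : m ≤ M := h.le_left.trans (h.left_le hm)

theorem sliceSup_pos (h : NearEquality m M δ A B) (hm : 0 < m) : 0 < sliceSup A := by
  have h1 := h.le_left.trans (measureReal_le_sliceSup_mul h.left_compact)
  exact pos_of_mul_pos_left (hm.trans_le h1) measureReal_nonneg

/-- The slices of the two sets are of comparable size: with $\pi B$ the projection, $m\le|B|\le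
b|\pi B|$ and $a|\pi B|\le|A+B|\le M$. -/
theorem sliceSup_mul_le (h : NearEquality m M δ A B) (hm : 0 < m) :
    sliceSup A * m ≤ M * sliceSup B := by
  have h1 := h.symm.le_left.trans (measureReal_le_sliceSup_mul h.right_compact)
  have h2 := sliceSup_mul_measureReal_le h.right_compact h.left_compact
  rw [add_comm] at h2
  have h3 := h2.trans h.add_le
  have ha := h.sliceSup_pos hm
  have hb := h.symm.sliceSup_pos hm
  nlinarith

theorem sliceSup_mul_image_fst_le (h : NearEquality m M δ A B) (hm : 0 < m) :
    sliceSup A * volume.real (Prod.fst '' A) ≤ M ^ 2 / m := by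
  have h1 := h.sliceSup_mul_le hm
  have h2 := (sliceSup_mul_measureReal_le h.left_compact h.right_compact).trans h.add_le
  have hM := hm.trans_le (h.le_bound hm)
  rw [le_div_iff₀ hm]
  have h3 : 0 ≤ volume.real (Prod.fst '' A) := measureReal_nonneg
  nlinarith

/-- Brunn-Minkowski on the line, applied to pairs of slices. -/
theorem superlevel_add_subset (hA : IsCompact A) (hB : IsCompact B) {s a b : ℝ} (hs : 0 < s)
    (ha : 0 < a) (hb : 0 < b) :
    {x | a * s ≤ volume.real (slice A x)} + {x | b * s ≤ volume.real (slice B x)} ⊆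
      {x | (a + b) * s ≤ volume.real (slice (A + B) x)} := by
  rintro _ ⟨x, hx, y, hy, rfl⟩
  have hx : a * s ≤ volume.real (slice A x) := hx
  have hy : b * s ≤ volume.real (slice B y) := hy
  have h1 := (hA.slice x).measureReal_add_le_measureReal_add (hB.slice y)
    (nonempty_of_measureReal_ne_zero ((by positivity : 0 < a * s).trans_le hx).ne')
    (nonempty_of_measureReal_ne_zero ((by positivity : 0 < b * s).trans_le hy).ne')
  have h2 := measureReal_mono (μ := volume) (slice_add_subset A B x y) ((hA.add hB).slice (x + y)).measure_ne_top
  change (a + b) * s ≤ volume.real (slice (A + B) (x + y))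
  linarith

theorem superlevel_nonempty {s : ℝ} (hs : s < 1) (ha : 0 < sliceSup A) :
    {x | sliceSup A * s ≤ volume.real (slice A x)}.Nonempty := by
  obtain ⟨x, hx⟩ := exists_lt_measureReal_slice (show sliceSup A * s < sliceSup A by nlinarith)
  exact ⟨x, hx.le⟩

/-- The part of `A` over low slices is small. -/
theorem measureReal_low_le (h : NearEquality m M δ A B) (hm : 0 < m) {s : ℝ} (hs : 0 ≤ s) :
    volume.real (A ∩ Prod.fst ⁻¹' {x | volume.real (slice A x) < sliceSup A * s}) ≤
      s * (M ^ 2 / m) := by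
  have hA := h.left_compact
  have ha := h.sliceSup_pos hm
  have hc := hA.image continuous_fst
  have hZ : MeasurableSet (Prod.fst '' A ∩ {x | volume.real (slice A x) < sliceSup A * s}) :=
    hc.measurableSet.inter (measurableSet_lt (measurable_measureReal_slice hA.measurableSet)
      measurable_const)
  have h1 := measureReal_inter_preimage_fst_le hA hZ
    ((measure_mono Set.inter_subset_left).trans_lt hc.measure_lt_top).ne
    (by positivity : 0 ≤ sliceSup A * s) fun x hx => hx.2.le
  have h2 := measureReal_mono (μ := volume) (Set.inter_subset_left :
    Prod.fst '' A ∩ {x | volume.real (slice A x) < sliceSup A * s} ⊆ _) hc.measure_ne_top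
  have h3 := h.sliceSup_mul_image_fst_le hm
  have h4 : A ∩ Prod.fst ⁻¹' {x | volume.real (slice A x) < sliceSup A * s} ⊆
      A ∩ Prod.fst ⁻¹' (Prod.fst '' A ∩ {x | volume.real (slice A x) < sliceSup A * s}) :=
    fun z hz => ⟨hz.1, ⟨z, hz.1, rfl⟩, hz.2⟩
  calc _ ≤ _ := measureReal_mono h4
        ((measure_mono Set.inter_subset_left).trans_lt hA.measure_lt_top).ne
    _ ≤ _ := h1
    _ ≤ sliceSup A * s * volume.real (Prod.fst '' A) := by gcongr
    _ = s * (sliceSup A * volume.real (Prod.fst '' A)) := by ring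
    _ ≤ _ := by gcongr

theorem le_superlevel (h : NearEquality m M δ A B) (hm : 0 < m) {s : ℝ} (hs : 0 < s)
    (hs' : s * (M ^ 2 / m) ≤ m / 2) :
    m / 2 ≤ sliceSup A * volume.real {x | sliceSup A * s ≤ volume.real (slice A x)} := by
  have hA := h.left_compact
  have ha := h.sliceSup_pos hm
  have hE := isCompact_superlevel_slice hA (by positivity : 0 < sliceSup A * s)
  have h1 := h.measureReal_low_le hm hs.le
  have h2 := measureReal_inter_preimage_fst_le hA hE.measurableSet hE.measure_ne_top ha.le
    fun x _ => hA.measureReal_slice_le x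
  have h3 : A ⊆ (A ∩ Prod.fst ⁻¹' {x | volume.real (slice A x) < sliceSup A * s}) ∪
      (A ∩ Prod.fst ⁻¹' {x | sliceSup A * s ≤ volume.real (slice A x)}) := fun z hz => by
    rcases lt_or_ge (volume.real (slice A z.1)) (sliceSup A * s) with h | h
    · exact Or.inl ⟨hz, h⟩
    · exact Or.inr ⟨hz, h⟩
  have h4 := (measureReal_mono (μ := volume) h3 ((measure_mono (Set.union_subset Set.inter_subset_left
    Set.inter_subset_left)).trans_lt hA.measure_lt_top).ne).trans (measureReal_union_le _ _)
  linarith [h.le_left]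

/-- Some low superlevel set of the slice length must be a near-interval, since otherwise stability
on the line would yield a gain at every level below `s0`. The interval then carries almost all of
`A`: little mass lies over low slices, and the exceptional part of the superlevel set is small. -/
theorem exists_localization {m η : ℝ} (M : ℝ) (hm : 0 < m) (hη : 0 < η) :
    ∃ δ > 0, ∀ A B : Set (ℝ × ℝ), NearEquality m M δ A B → ∃ l r, l ≤ r ∧
      (r - l) * sliceSup A ≤ M ^ 2 / m + η ∧
      volume.real (A \ Prod.fst ⁻¹' Set.Icc l r) ≤ η := by
  rcases lt_or_ge M m with hM | hM
  · exact ⟨1, one_pos, fun A B h => absurd (h.le_bound hm) (not_le.2 hM)⟩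
  have hM0 : 0 < M := hm.trans_le hM
  set C := M ^ 2 / m with hC
  have hC0 : 0 < C := by positivity
  set s0 := min 1 (min (η / (2 * C)) (m / (2 * C))) with hs0
  have hs0p : 0 < s0 := by positivity
  have hs01 : s0 ≤ 1 := min_le_left _ _
  have hs0η : s0 * C ≤ η / 2 := by
    have : s0 ≤ η / (2 * C) := (min_le_right _ _).trans (min_le_left _ _)
    rw [le_div_iff₀ (by positivity)] at this
    linarith
  have hs0m : s0 * C ≤ m / 2 := by
    have : s0 ≤ m / (2 * C) := (min_le_right _ _).trans (min_le_right _ _)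
    rw [le_div_iff₀ (by positivity)] at this
    linarith
  -- The bound `η / 4` limits the mass lost outside the interval. The bound `m ^ 2 / (2 * M)` makes
  -- both superlevel sets at least `ξ / a` long, as stability on the line requires.
  set ξ := min (η / 4) (m ^ 2 / (2 * M)) with hξ
  have hξp : 0 < ξ := by positivity
  have hξη : ξ ≤ η / 4 := min_le_left _ _
  have hξM : ξ * M ≤ m ^ 2 / 2 := by
    have : ξ ≤ m ^ 2 / (2 * M) := min_le_right _ _
    rw [le_div_iff₀ (by positivity)] at this
    linarith
  have hξm : ξ ≤ m / 2 := by
    have : ξ * m ≤ ξ * M := by gcongr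
    nlinarith
  refine ⟨ξ * s0 / 2, by positivity, fun A B h => ?_⟩
  have hA := h.left_compact
  have hB := h.right_compact
  have ha := h.sliceSup_pos hm
  have hb := h.symm.sliceSup_pos hm
  set a := sliceSup A with ha'
  set b := sliceSup B with hb'
  have hEc : ∀ s, 0 < s → IsCompact {x | a * s ≤ volume.real (slice A x)} := fun s hs =>
    isCompact_superlevel_slice hA (by positivity)
  have hFc : ∀ s, 0 < s → IsCompact {x | b * s ≤ volume.real (slice B x)} := fun s hs =>
    isCompact_superlevel_slice hB (by positivity)
  -- A gain `ξ / a` at all levels below `s0` adds at least `ξ * s0` to the measure of `A + B`, twice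
  -- the permitted deficit.
  obtain ⟨s, hs, hsN⟩ : ∃ s ∈ Set.Ioo 0 s0,
      NearInterval {x | a * s ≤ volume.real (slice A x)} (ξ / a) := by
    by_contra! hcon
    have hgain := lintegral_ge_of_superlevel (γ := ξ / a) (s0 := s0)
      (measurable_measureReal_slice hA.measurableSet)
      (measurable_measureReal_slice hB.measurableSet)
      (measurable_measureReal_slice (hA.add hB).measurableSet)
      (fun _ => measureReal_nonneg) (fun _ => measureReal_nonneg) (fun _ => measureReal_nonneg)
      ha hb hA.measureReal_slice_le hB.measureReal_slice_le hs01 ?_ measureReal_nonneg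
      measureReal_nonneg (lintegral_measureReal_slice hA) (lintegral_measureReal_slice hB)
      (by positivity) hs0p.le
    · rw [lintegral_measureReal_slice (hA.add hB), ENNReal.ofReal_le_ofReal_iff measureReal_nonneg]
        at hgain
      have h1 := sq_sqrt_add_sqrt_le (F := volume.real A) (G := volume.real B) measureReal_nonneg
        measureReal_nonneg ha hb
      have h2 : ξ * s0 ≤ (a + b) * (ξ / a * s0) := by
        have : ξ * s0 = a * (ξ / a * s0) := by field_simp
        rw [this]
        gcongr
        linarith
      have h3 := h.deficit
      have h4 : 0 < ξ * s0 := by positivity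
      rw [mul_add] at hgain
      linarith
    · intro s hs
      have hsub := superlevel_add_subset hA hB hs.1 ha hb
      refine le_trans ?_ (measure_mono hsub)
      have hE0 := superlevel_nonempty hs.2 ha
      have hF0 := superlevel_nonempty hs.2 hb
      have hEs := hEc s hs.1
      have hFs := hFc s hs.1
      rw [← ofReal_measureReal hEs.measure_ne_top, ← ofReal_measureReal hFs.measure_ne_top,
        ← ofReal_measureReal (hEs.add hFs).measure_ne_top,
        ← ENNReal.ofReal_add measureReal_nonneg measureReal_nonneg]
      by_cases hss : s ∈ Set.Ioo 0 s0
      · rw [Set.indicator_of_mem hss, ← ENNReal.ofReal_add (by positivity) (by positivity)]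
        refine ENNReal.ofReal_le_ofReal ?_
        by_contra! hlt
        have hsC : s * C ≤ m / 2 := (mul_le_mul_of_nonneg_right hss.2.le hC0.le).trans hs0m
        have hE1 := h.le_superlevel hm hss.1 hsC
        have hF1 := h.symm.le_superlevel hm hss.1 hsC
        refine hcon s hss (nearInterval_of_measureReal_add_lt hEs hFs (by positivity) ?_ ?_ hlt)
        · rw [div_le_iff₀ ha]
          linarith
        · rw [div_le_iff₀ ha]
          have h5 := h.symm.sliceSup_mul_le hm
          have h6 : 0 ≤ volume.real {x | b * s ≤ volume.real (slice B x)} := measureReal_nonneg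
          have h7 : ξ * M ≤ (volume.real {x | b * s ≤ volume.real (slice B x)} * a) * M := by
            nlinarith
          exact le_of_mul_le_mul_right h7 hM0
      · rw [Set.indicator_of_notMem hss, add_zero]
        exact ENNReal.ofReal_le_ofReal (hEs.measureReal_add_le_measureReal_add hFs hE0 hF0)
  obtain ⟨l, r, hlr, hlen, hout⟩ := hsN
  have hEs := hEc s hs.1
  refine ⟨l, r, hlr, ?_, ?_⟩
  · have h1 : volume.real {x | a * s ≤ volume.real (slice A x)} ≤ volume.real (Prod.fst '' A) :=
      measureReal_mono (superlevel_slice_subset (mul_pos ha hs.1))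
        (hA.image continuous_fst).measure_ne_top
    have h2 := h.sliceSup_mul_image_fst_le hm
    calc (r - l) * a ≤ (volume.real (Prod.fst '' A) + ξ / a) * a := by gcongr; linarith
      _ = a * volume.real (Prod.fst '' A) + ξ := by field_simp
      _ ≤ C + η := by linarith
  · set E := {x | a * s ≤ volume.real (slice A x)} with hE
    have hEJ : MeasurableSet (E \ Set.Icc l r) := hEs.measurableSet.diff measurableSet_Icc
    have h1 := measureReal_inter_preimage_fst_le hA hEJ
      ((measure_mono Set.sdiff_subset).trans_lt hEs.measure_lt_top).ne ha.le
      fun x _ => hA.measureReal_slice_le x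
    have h2 := h.measureReal_low_le hm hs.1.le
    have h3 : A \ Prod.fst ⁻¹' Set.Icc l r ⊆
        (A ∩ Prod.fst ⁻¹' {x | volume.real (slice A x) < a * s}) ∪
        (A ∩ Prod.fst ⁻¹' (E \ Set.Icc l r)) := fun z hz => by
      rcases lt_or_ge (volume.real (slice A z.1)) (a * s) with h | h
      · exact Or.inl ⟨hz.1, h⟩
      · exact Or.inr ⟨hz.1, h, hz.2⟩
    have h4 := (measureReal_mono (μ := volume) h3 ((measure_mono (Set.union_subset Set.inter_subset_left
      Set.inter_subset_left)).trans_lt hA.measure_lt_top).ne).trans (measureReal_union_le _ _)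
    have h5 : s * C ≤ η / 2 := (mul_le_mul_of_nonneg_right hs.2.le hC0.le).trans hs0η
    have h6 : a * volume.real (E \ Set.Icc l r) ≤ 2 * ξ := by
      calc _ ≤ a * (2 * (ξ / a)) := by gcongr
        _ = _ := by field_simp
    linarith

/-- Raise the slice-length function of `A` by `ζ * a` on the bad slices. Stability on the line makes
up for this increase in `A + B`, so Brunn-Minkowski holds with $|A|$ replaced by $|A|+\zeta
a|\mathrm{bad}|$, and the deficit bounds $|\mathrm{bad}|$. -/
theorem exists_nearInterval_slices {m η : ℝ} (M : ℝ) (hm : 0 < m) (hη : 0 < η) :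
    ∃ δ > 0, ∀ A B : Set (ℝ × ℝ), NearEquality m M δ A B → ∃ N : Set ℝ, MeasurableSet N ∧
      volume N ≠ ∞ ∧ volume.real N * sliceSup A ≤ η ∧
      ∀ x ∉ N, NearInterval (slice A x) (η * sliceSup A) := by
  rcases lt_or_ge M m with hM | hM
  · exact ⟨1, one_pos, fun A B h => absurd (h.le_bound hm) (not_le.2 hM)⟩
  have hM0 : 0 < M := hm.trans_le hM
  wlog hη1 : η ≤ 1 generalizing η
  · obtain ⟨δ, hδ, H⟩ := this one_pos le_rfl
    refine ⟨δ, hδ, fun A B h => ?_⟩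
    obtain ⟨N, h1, h2, h3, h4⟩ := H A B h
    have ha := h.sliceSup_pos hm
    exact ⟨N, h1, h2, by linarith, fun x hx => (h4 x hx).mono (by nlinarith)⟩
  -- Chosen so that at levels `s > η / 2` every slice of `B` of length at least `b * s` has length
  -- at least `ζ * a`, by `sliceSup_mul_le`.
  set ζ := η * m / (2 * M) with hζ
  have hζ0 : 0 < ζ := by positivity
  have hζM : ζ * M = η * m / 2 := by rw [hζ]; field_simp
  have hζη : ζ ≤ η / 2 := by
    rw [hζ, div_le_div_iff₀ (by positivity) two_pos]
    nlinarith
  refine ⟨ζ * η, by positivity, fun A B h => ?_⟩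
  have hA := h.left_compact
  have hB := h.right_compact
  have ha := h.sliceSup_pos hm
  have hb := h.symm.sliceSup_pos hm
  have hab := h.sliceSup_mul_le hm
  set a := sliceSup A with ha'
  set b := sliceSup B with hb'
  have hfm := measurable_measureReal_slice hA.measurableSet
  -- Rational endpoints make this set measurable; doubling the tolerance leaves room for rounding
  -- them.
  set good : Set ℝ := ⋃ (p : ℚ) (q : ℚ) (_ : p ≤ q),
    {x | (q : ℝ) - p ≤ volume.real (slice A x) + 2 * ζ * a} ∩
    {x | volume.real (slice A x \ Set.Icc (p : ℝ) q) ≤ 2 * (2 * ζ * a)} with hgood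
  have hgm : MeasurableSet good := by
    refine MeasurableSet.iUnion fun p => MeasurableSet.iUnion fun q => MeasurableSet.iUnion fun _ =>
      (measurableSet_le measurable_const (hfm.add_const _)).inter
        (measurableSet_le ?_ measurable_const)
    have h1 : MeasurableSet (A \ Prod.snd ⁻¹' Set.Icc (p : ℝ) q) :=
      hA.measurableSet.diff (measurable_snd measurableSet_Icc)
    exact measurable_measureReal_slice h1
  have hgN : ∀ x ∈ good, NearInterval (slice A x) (2 * ζ * a) := by
    intro x hx
    simp only [hgood, Set.mem_iUnion] at hx
    obtain ⟨p, q, hpq, h1, h2⟩ := hx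
    exact ⟨p, q, by exact_mod_cast hpq, h1, h2⟩
  have hNg : ∀ x, NearInterval (slice A x) (ζ * a) → x ∈ good := by
    rintro x ⟨p, q, hpq, h1, h2⟩
    have hζa : 0 < ζ * a := by positivity
    obtain ⟨p', hp1, hp2⟩ := exists_rat_btwn (show p - ζ * a / 2 < p by linarith)
    obtain ⟨q', hq1, hq2⟩ := exists_rat_btwn (show q < q + ζ * a / 2 by linarith)
    simp only [hgood, Set.mem_iUnion]
    refine ⟨p', q', by exact_mod_cast (hp2.trans_le (hpq.trans hq1.le)).le, ?_, ?_⟩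
    · change (q' : ℝ) - p' ≤ volume.real (slice A x) + 2 * ζ * a
      linarith
    · change volume.real (slice A x \ Set.Icc (p' : ℝ) q') ≤ 2 * (2 * ζ * a)
      have := measureReal_mono (μ := volume)
        (Set.sdiff_subset_sdiff_right (s := slice A x) (Set.Icc_subset_Icc hp2.le hq1.le))
        ((measure_mono Set.sdiff_subset).trans_lt (hA.slice x).measure_lt_top).ne
      linarith
  -- Only tall slices count as bad: those shorter than `η * a` are near-intervals trivially.
  set bad : Set ℝ := {x | η * a ≤ volume.real (slice A x)} \ good with hbad
  have hEc := isCompact_superlevel_slice hA (by positivity : 0 < η * a)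
  have hbm : MeasurableSet bad := hEc.measurableSet.diff hgm
  have hbfin : volume bad ≠ ∞ := ((measure_mono Set.sdiff_subset).trans_lt hEc.measure_lt_top).ne
  refine ⟨bad, hbm, hbfin, ?_, fun x hx => ?_⟩
  swap
  · by_cases hxg : x ∈ good
    · exact (hgN x hxg).mono (by nlinarith)
    · have hxs : volume.real (slice A x) < η * a := not_le.1 fun hle => hx ⟨hle, hxg⟩
      exact nearInterval_of_measureReal_le (by nlinarith) (hA.slice x).measure_ne_top (by positivity)
  set f : ℝ → ℝ := fun x => volume.real (slice A x) + bad.indicator (fun _ => ζ * a) x with hf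
  have hi0 : ∀ x, 0 ≤ bad.indicator (fun _ => ζ * a) x := fun x =>
    Set.indicator_nonneg (fun _ _ => by positivity) x
  have hi1 : ∀ x, bad.indicator (fun _ => ζ * a) x ≤ ζ * a := fun x =>
    Set.indicator_le_self' (fun _ _ => by positivity) x
  have hflow : ∀ x, volume.real (slice A x) ≤ f x := fun x => by
    simp only [hf]
    linarith [hi0 x]
  have hfup : ∀ x, f x ≤ 2 * a := fun x => by
    have := hA.measureReal_slice_le x
    have := hi1 x
    simp only [hf]
    nlinarith
  have hfbdd : BddAbove (Set.range f) := ⟨2 * a, Set.forall_mem_range.2 hfup⟩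
  set a' := ⨆ x, f x with ha''
  have haa' : a ≤ a' := ciSup_mono hfbdd hflow
  have ha'0 : 0 < a' := ha.trans_le haa'
  have ha'2 : a' ≤ 2 * a := ciSup_le hfup
  have hfmeas : Measurable f := hfm.add (measurable_const.indicator hbm)
  -- The gain is already built into `f`, so no extra term is needed at any level.
  have hgain := lintegral_ge_of_superlevel (γ := 0) (s0 := 0) hfmeas
    (measurable_measureReal_slice hB.measurableSet)
    (measurable_measureReal_slice (hA.add hB).measurableSet)
    (fun x => measureReal_nonneg.trans (hflow x)) (fun _ => measureReal_nonneg)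
    (fun _ => measureReal_nonneg) ha'0 hb (le_ciSup hfbdd) hB.measureReal_slice_le zero_le_one ?_
    (F := volume.real A + ζ * a * volume.real bad) (by positivity)
    measureReal_nonneg ?_ (lintegral_measureReal_slice hB) le_rfl le_rfl
  · rw [lintegral_measureReal_slice (hA.add hB), ENNReal.ofReal_le_ofReal_iff measureReal_nonneg,
      mul_zero, add_zero] at hgain
    have hw : 0 ≤ ζ * a * volume.real bad := by positivity
    have hA0 : 0 ≤ volume.real A := measureReal_nonneg
    have hB0 : 0 ≤ volume.real B := measureReal_nonneg
    have h1 := sq_sqrt_add_sqrt_le (F := volume.real A + ζ * a * volume.real bad)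
      (G := volume.real B) (by positivity) measureReal_nonneg ha'0 hb
    have h2 := h.deficit
    have h3 : √(volume.real A) ≤ √(volume.real A + ζ * a * volume.real bad) :=
      Real.sqrt_le_sqrt (by linarith)
    have h4 : ζ * a * volume.real bad ≤ ζ * η := by
      nlinarith [Real.sq_sqrt hA0, Real.sq_sqrt hB0, Real.sqrt_nonneg (volume.real B),
        Real.sq_sqrt (by positivity : 0 ≤ volume.real A + ζ * a * volume.real bad),
        mul_le_mul_of_nonneg_right h3 (Real.sqrt_nonneg (volume.real B))]
    refine le_of_mul_le_mul_left ?_ hζ0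
    linarith
  · intro s hs
    rw [Set.Ioo_self, Set.indicator_empty, add_zero]
    have hEm : MeasurableSet {x | a' * s ≤ f x} := measurableSet_le measurable_const hfmeas
    have hFc := isCompact_superlevel_slice hB (by have := hs.1; positivity : 0 < b * s)
    have hE0 : {x | a' * s ≤ f x}.Nonempty := by
      obtain ⟨x, hx⟩ := exists_lt_of_lt_ciSup (show a' * s < ⨆ x, f x by
        rw [← ha'']; nlinarith [hs.2])
      exact ⟨x, hx.le⟩
    refine (measure_add_le_measure_add_of_measurableSet hEm hFc.measurableSet hE0
      (superlevel_nonempty hs.2 hb)).trans (measure_mono ?_)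
    rintro _ ⟨x, hx, y, hy, rfl⟩
    have hx : a' * s ≤ f x := hx
    have hy : b * s ≤ volume.real (slice B y) := hy
    change (a' + b) * s ≤ volume.real (slice (A + B) (x + y))
    have hs0 := hs.1
    have hfx : 0 < f x := (by positivity : 0 < a' * s).trans_le hx
    have hgy : 0 < volume.real (slice B y) := (by positivity : 0 < b * s).trans_le hy
    have hsx : 0 < volume.real (slice A x) := by
      by_cases hxb : x ∈ bad
      · exact (by positivity : 0 < η * a).trans_le hxb.1
      · simpa [hf, Set.indicator_of_notMem hxb] using hfx
    have h1 := (hA.slice x).measureReal_add_le_measureReal_add (hB.slice y)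
      (nonempty_of_measureReal_ne_zero hsx.ne') (nonempty_of_measureReal_ne_zero hgy.ne')
    have h2 := measureReal_mono (μ := volume) (slice_add_subset A B x y)
      ((hA.add hB).slice (x + y)).measure_ne_top
    by_cases hxb : x ∈ bad
    swap
    · have : f x = volume.real (slice A x) := by simp [hf, Set.indicator_of_notMem hxb]
      linarith
    have hfx' : f x = volume.real (slice A x) + ζ * a := by simp [hf, Set.indicator_of_mem hxb]
    have hxη : η * a ≤ volume.real (slice A x) := hxb.1
    -- At low levels a bad slice already reaches the height `a' * s` without its increment. At the
    -- others `s > η / 2`, because `a' ≤ 2 * a`, and stability on the line applies.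
    rcases le_or_gt (a' * s) (η * a) with hc | hc
    · linarith
    have hs2 : η < 2 * s := by nlinarith
    have hyζ : ζ * a ≤ volume.real (slice B y) := by
      have h3 : ζ * a * M ≤ b * s * M := by
        have h4 : s * (a * m) ≤ s * (M * b) := by gcongr
        have h5 : a * m * η ≤ a * m * (2 * s) := by gcongr
        have h6 : ζ * a * M = a * m * η / 2 := by linear_combination a * hζM
        linarith
      exact (le_of_mul_le_mul_right h3 hM0).trans hy
    by_contra! hlt
    exact hxb.2 (hNg x (nearInterval_of_measureReal_add_lt (hA.slice x) (hB.slice y)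
      (by positivity) (by nlinarith) hyζ (by linarith)))
  · have h1 : ∀ x, ENNReal.ofReal (f x) = ENNReal.ofReal (volume.real (slice A x)) +
        bad.indicator (fun _ => ENNReal.ofReal (ζ * a)) x := fun x => by
      simp only [hf]
      rw [ENNReal.ofReal_add measureReal_nonneg (hi0 x)]
      congr 1
      by_cases hxb : x ∈ bad
      · simp [Set.indicator_of_mem hxb]
      · simp [Set.indicator_of_notMem hxb]
    simp only [h1]
    rw [lintegral_add_left (by fun_prop), lintegral_measureReal_slice hA,
      lintegral_indicator_const hbm, ← ofReal_measureReal hbfin,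
      ← ENNReal.ofReal_mul (by positivity), ENNReal.ofReal_add measureReal_nonneg (by positivity)]

end NearEquality

/-! ### Measure-preserving linear maps and normalization. -/

/-- The linear automorphism `(x, y) ↦ (αx, α⁻¹y + γx)` of the plane. -/
noncomputable def diagShear (α γ : ℝ) (hα : 0 < α) : (ℝ × ℝ) ≃L[ℝ] (ℝ × ℝ) :=
  LinearEquiv.toContinuousLinearEquiv
    { toFun := fun p => (α * p.1, α⁻¹ * p.2 + γ * p.1)
      invFun := fun p => (α⁻¹ * p.1, α * (p.2 - γ * (α⁻¹ * p.1)))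
      map_add' := fun p q => by ext <;> simp <;> ring
      map_smul' := fun c p => by ext <;> simp <;> ring
      left_inv := fun p => by
        ext
        · simp [hα.ne']
        · simp [hα.ne']
      right_inv := fun p => by
        ext
        · simp [hα.ne']
        · simp [hα.ne'] }

@[simp]
theorem diagShear_apply {α : ℝ} (γ : ℝ) (hα : 0 < α) (p : ℝ × ℝ) :
    diagShear α γ hα p = (α * p.1, α⁻¹ * p.2 + γ * p.1) := rfl

theorem measurePreserving_diagShear {α : ℝ} (γ : ℝ) (hα : 0 < α) :
    MeasurePreserving (diagShear α γ hα) volume volume := by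
  have h1 : MeasurePreserving (fun x : ℝ => α * x) volume (ENNReal.ofReal |α⁻¹| • volume) :=
    ⟨by fun_prop, Real.map_volume_mul_left hα.ne'⟩
  have h := h1.skew_product (g := fun x y => α⁻¹ * y + γ * x) (μc := (volume : Measure ℝ))
    (μd := ENNReal.ofReal |α| • volume) (by fun_prop) (Eventually.of_forall fun x => by
      have e : (fun y : ℝ => α⁻¹ * y + γ * x) = (fun y => y + γ * x) ∘ fun y => α⁻¹ * y := rfl
      rw [e, ← Measure.map_map (by fun_prop) (by fun_prop),
        Real.map_volume_mul_left (inv_ne_zero hα.ne'), inv_inv, Measure.map_smul,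
        map_add_right_eq_self])
  have e : (ENNReal.ofReal |α⁻¹| • (volume : Measure ℝ)).prod (ENNReal.ofReal |α| • volume) =
      (volume : Measure (ℝ × ℝ)) := by
    rw [Measure.prod_smul_left, Measure.prod_smul_right, smul_smul,
      ← ENNReal.ofReal_mul (abs_nonneg _), ← abs_mul, inv_mul_cancel₀ hα.ne', abs_one,
      ENNReal.ofReal_one, one_smul, Measure.volume_eq_prod]
  rw [e] at h
  exact h

/-- The linear automorphism sending the lines of slope `m` to vertical lines:
`(x, mx + k) ↦ (k, x)`. -/
noncomputable def slant (m : ℝ) : (ℝ × ℝ) ≃L[ℝ] (ℝ × ℝ) :=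
  (diagShear 1 (-m) one_pos).trans (ContinuousLinearEquiv.prodComm ℝ ℝ ℝ)

@[simp]
theorem slant_apply (m : ℝ) (p : ℝ × ℝ) : slant m p = (p.2 - m * p.1, p.1) := by
  simp [slant, sub_eq_add_neg]

theorem measurePreserving_slant (m : ℝ) : MeasurePreserving (slant m) volume volume := by
  have h := (Measure.measurePreserving_swap (μ := (volume : Measure ℝ)) (ν := volume)).comp
    (measurePreserving_diagShear (-m) one_pos)
  exact h

theorem mem_slice_slant {A : Set (ℝ × ℝ)} {m k x : ℝ} :
    x ∈ slice (slant m '' A) k ↔ (x, m * x + k) ∈ A := by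
  rw [mem_slice]
  constructor
  · rintro ⟨⟨u, v⟩, h, he⟩
    rw [slant_apply, Prod.mk.injEq] at he
    obtain ⟨rfl, rfl⟩ := he
    simpa using h
  · intro h
    exact ⟨_, h, by simp⟩

theorem MeasureTheory.MeasurePreserving.measureReal_image {e : (ℝ × ℝ) ≃L[ℝ] (ℝ × ℝ)}
    (he : MeasurePreserving e volume volume) (S : Set (ℝ × ℝ)) :
    volume.real (e '' S) = volume.real S := by
  have h : MeasurePreserving e.toHomeomorph.toMeasurableEquiv volume volume := he
  have h1 := h.measure_preimage_equiv (e '' S)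
  rw [measureReal_def, measureReal_def, ← h1]
  congr 2
  exact e.injective.preimage_image S

theorem NearEquality.image {m M δ : ℝ} {A B : Set (ℝ × ℝ)} (h : NearEquality m M δ A B)
    {e : (ℝ × ℝ) ≃L[ℝ] (ℝ × ℝ)} (he : MeasurePreserving e volume volume) :
    NearEquality m M δ (e '' A) (e '' B) where
  left_compact := h.left_compact.image e.continuous
  right_compact := h.right_compact.image e.continuous
  le_left := by rw [he.measureReal_image]; exact h.le_left
  le_right := by rw [he.measureReal_image]; exact h.le_right
  add_le := by rw [← Set.image_add, he.measureReal_image]; exact h.add_le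
  deficit := by
    rw [← Set.image_add, he.measureReal_image, he.measureReal_image, he.measureReal_image]
    exact h.deficit

theorem sliceSup_image_diagShear {α : ℝ} (γ : ℝ) (hα : 0 < α) (A : Set (ℝ × ℝ)) :
    sliceSup (diagShear α γ hα '' A) = α⁻¹ * sliceSup A := by
  have h : ∀ x, volume.real (slice (diagShear α γ hα '' A) (α * x)) =
      α⁻¹ * volume.real (slice A x) := by
    intro x
    have e : slice (diagShear α γ hα '' A) (α * x) = (fun y => y + γ * x) '' (α⁻¹ • slice A x) := by
      ext z
      rw [mem_slice]
      constructor
      · rintro ⟨⟨u, v⟩, huv, he⟩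
        rw [diagShear_apply, Prod.mk.injEq] at he
        obtain ⟨h1, rfl⟩ := he
        obtain rfl : u = x := mul_left_cancel₀ hα.ne' h1
        exact ⟨_, ⟨v, huv, rfl⟩, rfl⟩
      · rintro ⟨_, ⟨v, hv, rfl⟩, rfl⟩
        exact ⟨(x, v), hv, rfl⟩
    rw [e, Real.volume_real_image_add_const, measureReal_def, Measure.addHaar_smul]
    simp [measureReal_def, abs_of_pos hα, hα.le]
  rw [sliceSup, sliceSup, Real.mul_iSup_of_nonneg (by positivity),
    ← (Equiv.mulLeft₀ α hα.ne').iSup_comp]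
  exact iSup_congr h

theorem sliceSup_slant_le {A : Set (ℝ × ℝ)} (hA : IsCompact A) (m : ℝ) :
    sliceSup (slant m '' A) ≤ volume.real (Prod.fst '' A) := by
  refine (hA.image (slant m).continuous).sliceSup_le.trans_eq ?_
  rw [Set.image_image]
  simp

theorem sliceSup_pos {A : Set (ℝ × ℝ)} (hA : IsCompact A) (h : 0 < volume.real A) :
    0 < sliceSup A :=
  pos_of_mul_pos_left (h.trans_le (measureReal_le_sliceSup_mul hA)) measureReal_nonneg

/-- A diagonal map makes the vertical supremum 1; a shear, which preserves it, then turns a nearly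
optimal slope into the horizontal one. Slices along sloping lines are measured by their projections
to the first axis. -/
theorem exists_normalization {A : Set (ℝ × ℝ)} (hA : IsCompact A) (h : 0 < volume.real A) :
    ∃ e : (ℝ × ℝ) ≃L[ℝ] (ℝ × ℝ), MeasurePreserving e volume volume ∧ sliceSup (e '' A) = 1 ∧
      ∀ m, sliceSup (slant m '' (e '' A)) ≤ 2 * sliceSup (slant 0 '' (e '' A)) := by
  have ha := sliceSup_pos hA h
  set e1 := diagShear (sliceSup A) 0 ha with he1
  have he1m : MeasurePreserving e1 volume volume := measurePreserving_diagShear 0 ha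
  set A1 := e1 '' A with hA1
  have hA1c : IsCompact A1 := hA.image e1.continuous
  have hA1s : sliceSup A1 = 1 := by
    rw [hA1, he1, sliceSup_image_diagShear, inv_mul_cancel₀ ha.ne']
  have hpos : ∀ m, 0 < sliceSup (slant m '' A1) := fun m => by
    refine sliceSup_pos (hA1c.image (slant m).continuous) ?_
    rwa [(measurePreserving_slant m).measureReal_image, he1m.measureReal_image]
  have hbdd : BddAbove (Set.range fun m => sliceSup (slant m '' A1)) :=
    ⟨_, Set.forall_mem_range.2 (sliceSup_slant_le hA1c)⟩
  have hsup : 0 < ⨆ m, sliceSup (slant m '' A1) := (hpos 0).trans_le (le_ciSup hbdd 0)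
  -- The supremum over slopes need not be attained, whence the factor 2.
  obtain ⟨m0, hm0⟩ := exists_lt_of_lt_ciSup (half_lt_self hsup)
  refine ⟨e1.trans (diagShear 1 (-m0) one_pos),
    (measurePreserving_diagShear (-m0) one_pos).comp he1m, ?_, ?_⟩
  · have : (e1.trans (diagShear 1 (-m0) one_pos)) '' A = diagShear 1 (-m0) one_pos '' A1 := by
      rw [hA1, Set.image_image]
      rfl
    rw [this, sliceSup_image_diagShear, hA1s, inv_one, one_mul]
  · have : ∀ m, slant m '' ((e1.trans (diagShear 1 (-m0) one_pos)) '' A) =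
        slant (m + m0) '' A1 := by
      intro m
      rw [hA1, Set.image_image, Set.image_image]
      refine Set.image_congr fun p _ => ?_
      simp only [ContinuousLinearEquiv.trans_apply, slant_apply, diagShear_apply]
      ext
      · simp
        ring
      · simp
    intro m
    rw [this, this, zero_add]
    have := le_ciSup hbdd (m + m0)
    linarith

/-! ### Pairs of points counted along lines. -/

/-- Change of variables from the ordinates over `x` and `x'` to the slope and intercept of the
joining line; the Jacobian is $|x'-x|$. -/
theorem measure_mul_measure_eq_slope_intercept {x x' : ℝ} (hx : x ≠ x') {X X' : Set ℝ}
    (hX : MeasurableSet X) (hX' : MeasurableSet X') :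
    volume X * volume X' = ENNReal.ofReal |x' - x| *
      volume {q : ℝ × ℝ | q.1 * x + q.2 ∈ X ∧ q.1 * x' + q.2 ∈ X'} := by
  have hd : x' - x ≠ 0 := sub_ne_zero.2 hx.symm
  have h1 : MeasurePreserving (fun q : ℝ × ℝ => (q.2 + x * q.1, q.1)) volume volume := by
    have := (Measure.measurePreserving_swap (μ := (volume : Measure ℝ)) (ν := volume)).comp
      (measurePreserving_diagShear x one_pos)
    have e : (fun q : ℝ × ℝ => (q.2 + x * q.1, q.1)) = Prod.swap ∘ diagShear 1 x one_pos := by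
      ext q <;> simp
    rw [e]
    exact this
  have h2 := (MeasurePreserving.id (volume : Measure ℝ)).skew_product
    (g := fun y s => (x' - x) * s + y) (μc := (volume : Measure ℝ))
    (μd := ENNReal.ofReal |(x' - x)⁻¹| • volume) (by fun_prop) (Eventually.of_forall fun y => by
      have e : (fun s : ℝ => (x' - x) * s + y) = (fun s => s + y) ∘ fun s => (x' - x) * s := rfl
      rw [e, ← Measure.map_map (by fun_prop) (by fun_prop),
        Real.map_volume_mul_left hd, Measure.map_smul, map_add_right_eq_self])
  have h3 := (h2.comp h1).measure_preimage (hX.prod hX').nullMeasurableSet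
  have e : ((fun p : ℝ × ℝ => (id p.1, (x' - x) * p.2 + p.1)) ∘ fun q : ℝ × ℝ =>
      (q.2 + x * q.1, q.1)) ⁻¹' (X ×ˢ X') =
      {q : ℝ × ℝ | q.1 * x + q.2 ∈ X ∧ q.1 * x' + q.2 ∈ X'} := by
    ext q
    simp only [Function.comp, Set.mem_preimage, Set.mem_prod, id, Set.mem_ofPred_eq]
    rw [show q.2 + x * q.1 = q.1 * x + q.2 by ring,
      show (x' - x) * q.1 + (q.1 * x + q.2) = q.1 * x' + q.2 by ring]
  rw [e, Measure.prod_prod, Measure.smul_apply, smul_eq_mul] at h3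
  rw [h3, mul_left_comm, ← mul_assoc (ENNReal.ofReal |x' - x|),
    ← ENNReal.ofReal_mul (abs_nonneg _), ← abs_mul, mul_inv_cancel₀ hd]
  simp

theorem MeasurableSet.slice {A : Set (ℝ × ℝ)} (hA : MeasurableSet A) (x : ℝ) :
    MeasurableSet (slice A x) :=
  measurable_prodMk_left hA

/-- For a fixed first point, the points at horizontal distance below `c` lie in a strip of width `2
* c`, with slices of length at most 1. -/
theorem measure_pairs_le_lintegral_far {A : Set (ℝ × ℝ)} (hA : MeasurableSet A) {c : ℝ}
    (hA1 : ∀ x, volume (slice A x) ≤ 1) :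
    volume A * (volume A - ENNReal.ofReal (2 * c)) ≤
      ∫⁻ p : ℝ × ℝ, {p : ℝ × ℝ | c ≤ |p.1 - p.2|}.indicator
        (fun p => volume (slice A p.1) * volume (slice A p.2)) p := by
  have hFm : Measurable fun x => volume (slice A x) := measurable_measure_prodMk_left hA
  have hAF : volume A = ∫⁻ x, volume (slice A x) := by
    rw [Measure.volume_eq_prod, Measure.prod_apply hA]
    rfl
  have hfarm : MeasurableSet {p : ℝ × ℝ | c ≤ |p.1 - p.2|} :=
    measurableSet_le measurable_const (by fun_prop)
  have hmeas : Measurable ({p : ℝ × ℝ | c ≤ |p.1 - p.2|}.indicator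
      (fun p => volume (slice A p.1) * volume (slice A p.2))) :=
    ((hFm.comp measurable_fst).mul (hFm.comp measurable_snd)).indicator hfarm
  rw [Measure.volume_eq_prod, lintegral_prod _ hmeas.aemeasurable, ← Measure.volume_eq_prod]
  nth_rewrite 1 [hAF]
  rw [← lintegral_mul_const _ hFm]
  refine lintegral_mono fun x => ?_
  have hm : MeasurableSet {x' | c ≤ |x - x'|} := measurableSet_le measurable_const (by fun_prop)
  have e : ∀ x', {p : ℝ × ℝ | c ≤ |p.1 - p.2|}.indicator
      (fun p : ℝ × ℝ => volume (slice A p.1) * volume (slice A p.2)) (x, x') =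
      volume (slice A x) * {x' | c ≤ |x - x'|}.indicator (fun x' => volume (slice A x')) x' := by
    intro x'
    by_cases h : c ≤ |x - x'| <;> simp [h]
  simp only [e]
  rw [lintegral_const_mul _ (hFm.indicator hm)]
  gcongr
  rw [tsub_le_iff_right, lintegral_indicator hm, hAF, ← lintegral_add_compl _ hm]
  gcongr
  have hcompl : {x' | c ≤ |x - x'|}ᶜ ⊆ Set.Ioo (x - c) (x + c) := by
    intro x' hx'
    have : |x - x'| < c := not_le.1 hx'
    rw [abs_lt] at this
    constructor <;> linarith
  calc ∫⁻ x' in {x' | c ≤ |x - x'|}ᶜ, volume (slice A x')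
      ≤ ∫⁻ x' in {x' | c ≤ |x - x'|}ᶜ, 1 := lintegral_mono fun x' => hA1 x'
    _ = volume {x' | c ≤ |x - x'|}ᶜ := by rw [setLIntegral_one]
    _ ≤ volume (Set.Ioo (x - c) (x + c)) := measure_mono hcompl
    _ = _ := by rw [Real.volume_Ioo]; congr 1; ring

/-- The pairs of points of `A` at horizontal distance at least `c`, counted along the lines that
join them. -/
theorem measure_pairs_le_lintegral_lines {A : Set (ℝ × ℝ)} (hA : MeasurableSet A)
    {l r u v c : ℝ} (hc : 0 < c) (hAb : A ⊆ Set.Icc l r ×ˢ Set.Icc u v)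
    (hA1 : ∀ x, volume (slice A x) ≤ 1) :
    volume A * (volume A - ENNReal.ofReal (2 * c)) ≤ ENNReal.ofReal (r - l) *
      ∫⁻ s in Set.Icc (-((v - u) / c)) ((v - u) / c), ∫⁻ k,
        volume {p : ℝ × ℝ | (p.1, s * p.1 + k) ∈ A ∧ (p.2, s * p.2 + k) ∈ A ∧ c ≤ |p.1 - p.2|} := by
  set S := (v - u) / c with hS
  set far : Set (ℝ × ℝ) := {p | c ≤ |p.1 - p.2|} with hfar
  set G : Set ((ℝ × ℝ) × (ℝ × ℝ)) := {z | (z.1.1, z.2.1 * z.1.1 + z.2.2) ∈ A ∧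
    (z.1.2, z.2.1 * z.1.2 + z.2.2) ∈ A ∧ c ≤ |z.1.1 - z.1.2|} with hG
  have hGm : MeasurableSet G := by
    have h1 : Measurable fun z : (ℝ × ℝ) × (ℝ × ℝ) => (z.1.1, z.2.1 * z.1.1 + z.2.2) := by fun_prop
    have h2 : Measurable fun z : (ℝ × ℝ) × (ℝ × ℝ) => (z.1.2, z.2.1 * z.1.2 + z.2.2) := by fun_prop
    have h3 : Measurable fun z : (ℝ × ℝ) × (ℝ × ℝ) => |z.1.1 - z.1.2| := by fun_prop
    exact (h1 hA).inter ((h2 hA).inter (measurableSet_le measurable_const h3))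
  set ν : Measure (ℝ × ℝ) := (volume.restrict (Set.Icc (-S) S)).prod volume with hν
  have hνr : ν = (volume : Measure (ℝ × ℝ)).restrict (Set.Icc (-S) S ×ˢ Set.univ) := by
    rw [hν, Measure.volume_eq_prod, ← Measure.prod_restrict, Measure.restrict_univ]
  refine (measure_pairs_le_lintegral_far (c := c) hA hA1).trans ?_
  have hpt : ∀ p : ℝ × ℝ,
      far.indicator (fun p => volume (slice A p.1) * volume (slice A p.2)) p ≤
        ENNReal.ofReal (r - l) * ν {q | (p, q) ∈ G} := by
    intro p
    by_cases hp : p ∈ far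
    swap
    · rw [Set.indicator_of_notMem hp]
      exact zero_le
    rw [Set.indicator_of_mem hp]
    have hpc : c ≤ |p.1 - p.2| := hp
    have hne : p.1 ≠ p.2 := fun h => by rw [h, sub_self, abs_zero] at hpc; linarith
    by_cases hpI : p.1 ∈ Set.Icc l r ∧ p.2 ∈ Set.Icc l r
    swap
    · have : volume (slice A p.1) * volume (slice A p.2) = 0 := by
        rw [mul_eq_zero]
        by_contra! hcon
        refine hpI ⟨?_, ?_⟩
        · obtain ⟨y, hy⟩ := nonempty_of_measure_ne_zero hcon.1
          exact (hAb hy).1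
        · obtain ⟨y, hy⟩ := nonempty_of_measure_ne_zero hcon.2
          exact (hAb hy).1
      rw [this]
      exact zero_le
    rw [measure_mul_measure_eq_slope_intercept hne (hA.slice p.1) (hA.slice p.2)]
    refine mul_le_mul' (ENNReal.ofReal_le_ofReal ?_) ?_
    · rw [abs_le]
      constructor <;> linarith [hpI.1.1, hpI.1.2, hpI.2.1, hpI.2.2]
    · have hGp : MeasurableSet {q | (p, q) ∈ G} := hGm.preimage (by fun_prop)
      rw [hνr, Measure.restrict_apply hGp]
      refine measure_mono ?_
      rintro ⟨s, k⟩ ⟨h1, h2⟩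
      refine ⟨⟨h1, h2, hpc⟩, ⟨?_, trivial⟩⟩
      have h1' := (hAb h1).2
      have h2' := (hAb h2).2
      -- Two points of the box at horizontal distance at least `c` span a slope of size at most `(v
      -- - u) / c`.
      rw [Set.mem_Icc, ← abs_le, hS, le_div_iff₀ hc]
      calc |s| * c ≤ |s| * |p.1 - p.2| := by gcongr
        _ = |(s * p.1 + k) - (s * p.2 + k)| := by rw [← abs_mul]; congr 1; ring
        _ ≤ v - u := by
          simp only at h1' h2'
          rw [abs_le]
          constructor <;> linarith [h1'.1, h1'.2, h2'.1, h2'.2]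
  calc _ ≤ ∫⁻ p, ENNReal.ofReal (r - l) * ν {q | (p, q) ∈ G} := lintegral_mono hpt
    _ = ENNReal.ofReal (r - l) * ∫⁻ p, ν (Prod.mk p ⁻¹' G) :=
      lintegral_const_mul _ (measurable_measure_prodMk_left hGm)
    _ = ENNReal.ofReal (r - l) * ∫⁻ q, volume ((fun p => (p, q)) ⁻¹' G) ∂ν := by
      rw [← Measure.prod_apply hGm, Measure.prod_apply_symm hGm]
    _ = _ := by
      rw [hν, lintegral_prod _ (measurable_measure_prodMk_right hGm).aemeasurable]
      rfl

/-- The interval is shorter than `c`, so one point of a far pair lies in the exceptional part, of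
measure at most `2 * ζ`. -/
theorem NearInterval.volume_far_pairs_le {L : Set ℝ} {ζ c : ℝ} (h : NearInterval L ζ)
    (hL : IsCompact L) (hc : volume.real L + ζ < c) :
    volume {p : ℝ × ℝ | p.1 ∈ L ∧ p.2 ∈ L ∧ c ≤ |p.1 - p.2|} ≤
      ENNReal.ofReal (4 * ζ * volume.real L) := by
  obtain ⟨p, q, hpq, h1, h2⟩ := h
  set R := L \ Set.Icc p q with hR
  have hsub : {p : ℝ × ℝ | p.1 ∈ L ∧ p.2 ∈ L ∧ c ≤ |p.1 - p.2|} ⊆ R ×ˢ L ∪ L ×ˢ R := by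
    rintro ⟨x, x'⟩ ⟨hx, hx', hxx⟩
    by_cases hxI : x ∈ Set.Icc p q
    · by_cases hxI' : x' ∈ Set.Icc p q
      · exfalso
        have : |x - x'| ≤ q - p := by
          rw [abs_le]
          constructor <;> linarith [hxI.1, hxI.2, hxI'.1, hxI'.2]
        simp only at hxx
        linarith
      · exact Or.inr ⟨hx, hx', hxI'⟩
    · exact Or.inl ⟨⟨hx, hxI⟩, hx'⟩
  have hRf : volume R ≠ ∞ := ((measure_mono Set.sdiff_subset).trans_lt hL.measure_lt_top).ne
  have hL0 : 0 ≤ volume.real L := measureReal_nonneg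
  have hR0 : 0 ≤ volume.real R := measureReal_nonneg
  calc _ ≤ volume (R ×ˢ L ∪ L ×ˢ R) := measure_mono hsub
    _ ≤ volume (R ×ˢ L) + volume (L ×ˢ R) := measure_union_le _ _
    _ = ENNReal.ofReal (volume.real R * volume.real L + volume.real L * volume.real R) := by
      rw [Measure.volume_eq_prod, Measure.prod_prod, Measure.prod_prod,
        ENNReal.ofReal_add (by positivity) (by positivity), ENNReal.ofReal_mul hR0,
        ENNReal.ofReal_mul hL0, ofReal_measureReal hRf, ofReal_measureReal hL.measure_ne_top]
    _ ≤ _ := ENNReal.ofReal_le_ofReal (by nlinarith)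

/-- Near-interval slices contribute in proportion to their lengths, which integrate to $|A|$; each
exceptional slice contributes at most $a^2$. -/
theorem lintegral_far_pairs_le {A : Set (ℝ × ℝ)} (hA : IsCompact A) {N : Set ℝ}
    (hN : MeasurableSet N) (hNf : volume N ≠ ∞) {η M c : ℝ} (hη : 0 ≤ η)
    (hAM : volume.real A ≤ M) (hNη : volume.real N * sliceSup A ≤ η)
    (hI : ∀ x ∉ N, NearInterval (slice A x) (η * sliceSup A))
    (hc : sliceSup A + η * sliceSup A < c) :
    ∫⁻ k, volume {p : ℝ × ℝ | p.1 ∈ slice A k ∧ p.2 ∈ slice A k ∧ c ≤ |p.1 - p.2|} ≤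
      ENNReal.ofReal ((4 * M + 1) * η * sliceSup A) := by
  set a := sliceSup A with ha
  have ha0 : 0 ≤ a := measureReal_nonneg.trans (hA.measureReal_slice_le 0)
  have hpt : ∀ k, volume {p : ℝ × ℝ | p.1 ∈ slice A k ∧ p.2 ∈ slice A k ∧ c ≤ |p.1 - p.2|} ≤
      ENNReal.ofReal (4 * η * a) * ENNReal.ofReal (volume.real (slice A k)) +
        N.indicator (fun _ => ENNReal.ofReal (a * a)) k := by
    intro k
    have hk := hA.measureReal_slice_le k
    by_cases hkN : k ∈ N
    · rw [Set.indicator_of_mem hkN]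
      refine le_add_left ?_
      calc _ ≤ volume (slice A k ×ˢ slice A k) := measure_mono fun p hp => ⟨hp.1, hp.2.1⟩
        _ = ENNReal.ofReal (volume.real (slice A k) * volume.real (slice A k)) := by
          rw [Measure.volume_eq_prod, Measure.prod_prod, ENNReal.ofReal_mul measureReal_nonneg,
            ofReal_measureReal (hA.slice k).measure_ne_top]
        _ ≤ _ := ENNReal.ofReal_le_ofReal (mul_self_le_mul_self measureReal_nonneg hk)
    · rw [Set.indicator_of_notMem hkN, add_zero, ← ENNReal.ofReal_mul (by positivity), mul_assoc 4]
      exact (hI k hkN).volume_far_pairs_le (hA.slice k) (by linarith)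
  refine (lintegral_mono hpt).trans ?_
  have hm := measurable_measureReal_slice hA.measurableSet
  rw [lintegral_add_left (by fun_prop), lintegral_const_mul _ (by fun_prop),
    lintegral_measureReal_slice hA, lintegral_indicator_const hN, ← ofReal_measureReal hNf,
    ← ENNReal.ofReal_mul (by positivity), ← ENNReal.ofReal_mul (by positivity),
    ← ENNReal.ofReal_add (by positivity) (by positivity)]
  refine ENNReal.ofReal_le_ofReal ?_
  have h1 : 4 * η * a * volume.real A ≤ 4 * η * a * M := by gcongr
  have h2 : a * (volume.real N * a) ≤ a * η := by gcongr
  linarith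

/-- A normalized near-extremal set has a long horizontal slice: most pairs of its points lie on
lines meeting it in near-intervals. -/
theorem exists_le_sliceSup_slant_zero {m : ℝ} (M : ℝ) (hm : 0 < m) :
    ∃ c > 0, ∃ δ > 0, ∀ A B : Set (ℝ × ℝ), NearEquality m M δ A B → sliceSup A = 1 →
      (∀ s, sliceSup (slant s '' A) ≤ 2 * sliceSup (slant 0 '' A)) →
      c ≤ sliceSup (slant 0 '' A) := by
  rcases lt_or_ge M m with hM | hM
  · exact ⟨1, one_pos, 1, one_pos, fun A B h => absurd (h.le_bound hm) (not_le.2 hM)⟩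
  have hM0 : 0 < M := hm.trans_le hM
  set C := M ^ 2 / m + 1 with hC
  have hC0 : 0 < C := by positivity
  set c := m / 8 with hc
  have hc0 : 0 < c := by positivity
  set K := 4 * (C * C) * (4 * M + 1) / c with hK
  have hK0 : 0 < K := by positivity
  set η := min (min 1 (m / 4)) (m ^ 2 / (16 * K)) with hη
  have hη0 : 0 < η := by positivity
  have hη1 : η ≤ 1 := (min_le_left _ _).trans (min_le_left _ _)
  have hηm : η ≤ m / 4 := (min_le_left _ _).trans (min_le_right _ _)
  have hηK : η * K ≤ m ^ 2 / 16 := by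
    have : η ≤ m ^ 2 / (16 * K) := min_le_right _ _
    rw [le_div_iff₀ (by positivity)] at this
    linarith
  obtain ⟨δ1, hδ1, H1⟩ := NearEquality.exists_localization M hm hη0
  obtain ⟨δ2, hδ2, H2⟩ := NearEquality.exists_nearInterval_slices M hm hη0
  refine ⟨c / 4, by positivity, min δ1 δ2, by positivity, fun A B h hA1 hmax => ?_⟩
  -- If `a < c / 4`, then on every slope the slices have length at most `2 * a`, and with the
  -- tolerance this stays below `c`, so only few far pairs exist.
  by_contra! hlt
  have hA := h.left_compact
  have hs : ∀ s, NearEquality m M (min δ1 δ2) (slant s '' A) (slant s '' B) := fun s =>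
    h.image (measurePreserving_slant s)
  obtain ⟨l, r, hlr, hlen, hout⟩ := H1 A B (h.mono (min_le_left _ _))
  obtain ⟨u, v, huv, hlen', hout'⟩ := H1 _ _ ((hs 0).mono (min_le_left _ _))
  set a := sliceSup (slant 0 '' A) with ha
  have ha0 : 0 < a := (hs 0).sliceSup_pos hm
  rw [hA1, mul_one] at hlen
  set A0 := A ∩ Set.Icc l r ×ˢ Set.Icc u v with hA0
  have hA0c : IsCompact A0 := hA.inter_right (isClosed_Icc.prod isClosed_Icc)
  have hA0m : m / 2 ≤ volume.real A0 := by
    have h1 : A ⊆ A0 ∪ (A \ Prod.fst ⁻¹' Set.Icc l r ∪ A \ Prod.snd ⁻¹' Set.Icc u v) := by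
      intro p hp
      by_cases h1 : p.1 ∈ Set.Icc l r
      · by_cases h2 : p.2 ∈ Set.Icc u v
        · exact Or.inl ⟨hp, h1, h2⟩
        · exact Or.inr (Or.inr ⟨hp, h2⟩)
      · exact Or.inr (Or.inl ⟨hp, h1⟩)
    have h2 : volume.real (A \ Prod.snd ⁻¹' Set.Icc u v) ≤ η := by
      rw [← (measurePreserving_slant 0).measureReal_image]
      refine (measureReal_mono ?_ ((measure_mono Set.sdiff_subset).trans_lt
        (hs 0).left_compact.measure_lt_top).ne).trans hout'
      rintro _ ⟨p, ⟨hp, hp2⟩, rfl⟩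
      exact ⟨⟨p, hp, rfl⟩, by simpa using hp2⟩
    have h3 := (measureReal_mono (μ := volume) h1 ((measure_mono (Set.union_subset Set.inter_subset_left
      (Set.union_subset Set.sdiff_subset Set.sdiff_subset))).trans_lt hA.measure_lt_top).ne).trans
      ((measureReal_union_le _ _).trans (add_le_add_right (measureReal_union_le _ _) _))
    linarith [h.le_left]
  have hpairs := measure_pairs_le_lintegral_lines hA0c.measurableSet hc0
    (Set.inter_subset_right : A0 ⊆ _) fun x => by
      have h1 : slice A0 x ⊆ slice A x := fun y hy => hy.1
      refine (measure_mono h1).trans ?_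
      rw [← ofReal_measureReal (hA.slice x).measure_ne_top, ENNReal.ofReal_le_one, ← hA1]
      exact hA.measureReal_slice_le x
  have hline : ∀ s : ℝ, ∫⁻ k, volume {p : ℝ × ℝ |
      (p.1, s * p.1 + k) ∈ A0 ∧ (p.2, s * p.2 + k) ∈ A0 ∧ c ≤ |p.1 - p.2|} ≤
      ENNReal.ofReal ((4 * M + 1) * η * (2 * a)) := by
    intro s
    obtain ⟨N, hN, hNf, hNη, hNI⟩ := H2 _ _ ((hs s).mono (min_le_right _ _))
    have has := hmax s
    have has0 := (hs s).sliceSup_pos hm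
    have h1 := lintegral_far_pairs_le (hs s).left_compact hN hNf hη0.le ((hs s).left_le hm) hNη hNI
      (c := c) (by nlinarith)
    refine (lintegral_mono fun k => measure_mono ?_).trans
      (h1.trans (ENNReal.ofReal_le_ofReal (by gcongr)))
    rintro p ⟨h2, h3, h4⟩
    exact ⟨mem_slice_slant.2 h2.1, mem_slice_slant.2 h3.1, h4⟩
  have hup : ENNReal.ofReal (r - l) * ∫⁻ s in Set.Icc (-((v - u) / c)) ((v - u) / c), ∫⁻ k,
      volume {p : ℝ × ℝ | (p.1, s * p.1 + k) ∈ A0 ∧ (p.2, s * p.2 + k) ∈ A0 ∧ c ≤ |p.1 - p.2|} ≤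
      ENNReal.ofReal (m ^ 2 / 16) := by
    have hvu : 0 ≤ v - u := sub_nonneg.2 huv
    have hrl : 0 ≤ r - l := sub_nonneg.2 hlr
    calc _ ≤ ENNReal.ofReal (r - l) * ∫⁻ s in Set.Icc (-((v - u) / c)) ((v - u) / c),
          ENNReal.ofReal ((4 * M + 1) * η * (2 * a)) := by
          gcongr with s
          exact hline s
      _ = ENNReal.ofReal ((r - l) * ((4 * M + 1) * η * (2 * a) *
          ((v - u) / c - -((v - u) / c)))) := by
          rw [setLIntegral_const, Real.volume_Icc, ← ENNReal.ofReal_mul (by positivity),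
            ← ENNReal.ofReal_mul hrl]
      _ ≤ _ := by
          refine ENNReal.ofReal_le_ofReal ?_
          -- The range of slopes grows with the height `v - u` of the box, but localization bounds
          -- `(v - u) * a`, and the factor `a` comes from the bound on each slope. The estimate is
          -- therefore uniform in `a`.
          have e : (r - l) * ((4 * M + 1) * η * (2 * a) * ((v - u) / c - -((v - u) / c))) =
              ((r - l) * ((v - u) * a)) * (4 * (4 * M + 1) / c * η) := by ring
          rw [e]
          calc _ ≤ (C * C) * (4 * (4 * M + 1) / c * η) := by
                gcongr
                · linarith
                · linarith
            _ = η * K := by rw [hK]; ring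
            _ ≤ _ := hηK
  have hlow : ENNReal.ofReal (m ^ 2 / 8) ≤
      volume A0 * (volume A0 - ENNReal.ofReal (2 * c)) := by
    -- With `c = m / 8`, the far pairs have measure at least `m ^ 2 / 8`, against the upper bound `m
    -- ^ 2 / 16`.
    have e : m ^ 2 / 8 = (m / 2) * (m / 2 - 2 * c) := by rw [hc]; ring
    rw [e, ENNReal.ofReal_mul (by positivity), ENNReal.ofReal_sub _ (by positivity),
      ← ofReal_measureReal hA0c.measure_ne_top]
    gcongr
  have hfin := (hlow.trans (hpairs.trans hup))
  rw [ENNReal.ofReal_le_ofReal_iff (by positivity)] at hfin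
  nlinarith [sq_pos_of_pos hm]

/-! ### Uniform control in both coordinate directions. -/

/-- All vertical slices of `E`, off a set of abscissae of measure at most `η`, are close to
intervals. -/
def SlicesNearInterval (η : ℝ) (E : Set (ℝ × ℝ)) : Prop :=
  ∃ N : Set ℝ, MeasurableSet N ∧ volume N ≠ ∞ ∧ volume.real N ≤ η ∧
    ∀ x ∉ N, NearInterval (slice E x) η

theorem NearInterval.image_add_const {X : Set ℝ} {ζ : ℝ} (h : NearInterval X ζ) (c : ℝ) :
    NearInterval ((fun x => x + c) '' X) ζ := by
  obtain ⟨p, q, h1, h2, h3⟩ := h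
  refine ⟨p + c, q + c, by linarith, ?_, ?_⟩
  · rw [Real.volume_real_image_add_const]
    linarith
  · have : (fun x => x + c) '' X \ Set.Icc (p + c) (q + c) =
        (fun x => x + c) '' (X \ Set.Icc p q) := by
      rw [Set.image_sdiff (add_left_injective c), Set.image_add_const_Icc]
    rwa [this, Real.volume_real_image_add_const]

theorem slice_image_add_const (E : Set (ℝ × ℝ)) (w : ℝ × ℝ) (x : ℝ) :
    slice ((fun p => p + w) '' E) x = (fun y => y + w.2) '' slice E (x - w.1) := by
  ext y
  rw [mem_slice]
  constructor
  · rintro ⟨⟨u, v⟩, h, he⟩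
    obtain ⟨rfl, rfl⟩ : u + w.1 = x ∧ v + w.2 = y := Prod.mk.inj he
    exact ⟨v, by simpa [mem_slice] using h, rfl⟩
  · rintro ⟨v, hv, rfl⟩
    exact ⟨(x - w.1, v), hv, by ext <;> simp⟩

theorem SlicesNearInterval.image_add_const {η : ℝ} {E : Set (ℝ × ℝ)} (h : SlicesNearInterval η E)
    (w : ℝ × ℝ) : SlicesNearInterval η ((fun p => p + w) '' E) := by
  obtain ⟨N, h1, h2, h3, h4⟩ := h
  have e : (fun x => x - w.1) ⁻¹' N = (fun x => x + w.1) '' N := by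
    ext x
    constructor
    · intro hx
      exact ⟨x - w.1, hx, by simp⟩
    · rintro ⟨y, hy, rfl⟩
      simpa using hy
  refine ⟨(fun x => x - w.1) ⁻¹' N, h1.preimage (by fun_prop), ?_, ?_, fun x hx => ?_⟩
  · rw [e]
    simpa using h2
  · rwa [e, Real.volume_real_image_add_const]
  · rw [slice_image_add_const]
    exact (h4 _ hx).image_add_const _

theorem slant_zero_image_add_const (E : Set (ℝ × ℝ)) (w : ℝ × ℝ) :
    slant 0 '' ((fun p => p + w) '' E) = (fun p => p + w.swap) '' (slant 0 '' E) := by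
  rw [Set.image_image, Set.image_image]
  refine Set.image_congr fun p _ => ?_
  ext <;> simp

namespace NearEquality

variable {m M δ : ℝ} {A B : Set (ℝ × ℝ)}

/-- Once the slice suprema lie between `κ` and `Λ`, tolerances relative to them become absolute. The
size of the box does not depend on `η`. -/
theorem exists_box_and_slices {m κ Λ : ℝ} (M : ℝ) (hm : 0 < m) (hκ : 0 < κ) (hΛ : 0 < Λ) {η : ℝ}
    (hη : 0 < η) :
    ∃ δ > 0, ∀ A B : Set (ℝ × ℝ), NearEquality m M δ A B →
      sliceSup A ∈ Set.Icc κ Λ → sliceSup (slant 0 '' A) ∈ Set.Icc κ Λ →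
      SlicesNearInterval η A ∧ SlicesNearInterval η (slant 0 '' A) ∧ 
      ∃ u v : ℝ, volume.real (A \ Set.Icc u (u + (M ^ 2 / m + 1) / κ) ×ˢ
        Set.Icc v (v + (M ^ 2 / m + 1) / κ)) ≤ η := by
  set ξ := min 1 (min (η / 2) (min (η * κ) (η / Λ))) with hξ
  have hξ0 : 0 < ξ := by positivity
  have hξ1 : ξ ≤ 1 := min_le_left _ _
  have hξη : ξ ≤ η / 2 := (min_le_right _ _).trans (min_le_left _ _)
  have hξκ : ξ ≤ η * κ := (min_le_right _ _).trans ((min_le_right _ _).trans (min_le_left _ _))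
  have hξΛ : ξ * Λ ≤ η := by
    rw [← le_div_iff₀ hΛ]
    exact (min_le_right _ _).trans ((min_le_right _ _).trans (min_le_right _ _))
  obtain ⟨δ1, hδ1, H1⟩ := exists_localization M hm hξ0
  obtain ⟨δ2, hδ2, H2⟩ := exists_nearInterval_slices M hm hξ0
  refine ⟨min δ1 δ2, by positivity, fun A B h hA hA' => ?_⟩
  have key1 : ∀ A B : Set (ℝ × ℝ), NearEquality m M (min δ1 δ2) A B →
      sliceSup A ∈ Set.Icc κ Λ → SlicesNearInterval η A := by
    intro A B h hA
    obtain ⟨N, h1, h2, h3, h4⟩ := H2 A B (h.mono (min_le_right _ _))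
    refine ⟨N, h1, h2, ?_, fun x hx => (h4 x hx).mono ?_⟩
    · have : volume.real N * κ ≤ η * κ :=
        (mul_le_mul_of_nonneg_left hA.1 measureReal_nonneg).trans (h3.trans hξκ)
      exact le_of_mul_le_mul_right this hκ
    · exact (mul_le_mul_of_nonneg_left hA.2 hξ0.le).trans hξΛ
  have key2 : ∀ A B : Set (ℝ × ℝ), NearEquality m M (min δ1 δ2) A B →
      sliceSup A ∈ Set.Icc κ Λ →
      ∃ u, volume.real (A \ Prod.fst ⁻¹' Set.Icc u (u + (M ^ 2 / m + 1) / κ)) ≤ η / 2 := by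
    intro A B h hA
    obtain ⟨l, r, hlr, h1, h2⟩ := H1 A B (h.mono (min_le_left _ _))
    refine ⟨l, (measureReal_mono ?_ ?_).trans (h2.trans hξη)⟩
    · refine Set.sdiff_subset_sdiff_right (Set.preimage_mono (Set.Icc_subset_Icc_right ?_))
      have : (r - l) * κ ≤ M ^ 2 / m + 1 :=
        (mul_le_mul_of_nonneg_left hA.1 (sub_nonneg.2 hlr)).trans (h1.trans (by linarith))
      rw [← le_div_iff₀ hκ] at this
      linarith
    · exact ((measure_mono Set.sdiff_subset).trans_lt h.left_compact.measure_lt_top).ne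
  have h' := h.image (measurePreserving_slant 0)
  obtain ⟨u, hu⟩ := key2 A B h hA
  obtain ⟨v, hv⟩ := key2 _ _ h' hA'
  refine ⟨key1 A B h hA, key1 _ _ h' hA', u, v, ?_⟩
  set R := (M ^ 2 / m + 1) / κ
  have h2 : volume.real (A \ Prod.snd ⁻¹' Set.Icc v (v + R)) ≤ η / 2 := by
    rw [← (measurePreserving_slant 0).measureReal_image]
    refine (measureReal_mono ?_ ((measure_mono Set.sdiff_subset).trans_lt
      h'.left_compact.measure_lt_top).ne).trans hv
    rintro _ ⟨p, ⟨hp, hp2⟩, rfl⟩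
    exact ⟨⟨p, hp, rfl⟩, by simpa using hp2⟩
  have h3 : A \ Set.Icc u (u + R) ×ˢ Set.Icc v (v + R) ⊆
      A \ Prod.fst ⁻¹' Set.Icc u (u + R) ∪ A \ Prod.snd ⁻¹' Set.Icc v (v + R) := by
    rintro p ⟨hp, hpQ⟩
    by_cases h1 : p.1 ∈ Set.Icc u (u + R)
    · exact Or.inr ⟨hp, fun h2 => hpQ ⟨h1, h2⟩⟩
    · exact Or.inl ⟨hp, h1⟩
  have h4 := (measureReal_mono (μ := volume) h3 ((measure_mono (Set.union_subset Set.sdiff_subset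
    Set.sdiff_subset)).trans_lt h.left_compact.measure_lt_top).ne).trans (measureReal_union_le _ _)
  linarith

/-- The size of both sets of a normalized near-extremal pair is controlled in both coordinate
directions. -/
theorem exists_sliceSup_bounds {m : ℝ} (M : ℝ) (hm : 0 < m) :
    ∃ κ > 0, ∃ Λ > 0, ∃ δ > 0, ∀ A B : Set (ℝ × ℝ), NearEquality m M δ A B → sliceSup A = 1 →
      (∀ s, sliceSup (slant s '' A) ≤ 2 * sliceSup (slant 0 '' A)) →
      (sliceSup A ∈ Set.Icc κ Λ ∧ sliceSup (slant 0 '' A) ∈ Set.Icc κ Λ) ∧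
      (sliceSup B ∈ Set.Icc κ Λ ∧ sliceSup (slant 0 '' B) ∈ Set.Icc κ Λ) := by
  rcases lt_or_ge M m with hM | hM
  · exact ⟨1, one_pos, 1, one_pos, 1, one_pos,
      fun A B h => absurd (h.le_bound hm) (not_le.2 hM)⟩
  have hM0 : 0 < M := hm.trans_le hM
  obtain ⟨c, hc, δ, hδ, H⟩ := exists_le_sliceSup_slant_zero M hm
  set κ := min 1 c * (m / M) with hκ
  set Λ := max 1 (M ^ 2 / m) * (M / m) with hΛ
  have hmM : m / M ≤ 1 := (div_le_one hM0).2 hM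
  have hMm : 1 ≤ M / m := (one_le_div hm).2 hM
  refine ⟨κ, by positivity, Λ, by positivity, δ, hδ, fun A B h hA1 hmax => ?_⟩
  have hc1 : 0 < min 1 c := by positivity
  have hC1 : 0 < max 1 (M ^ 2 / m) := by positivity
  have hlow := H A B h hA1 hmax
  have hup := sliceSup_slant_le h.left_compact 0
  have hp := h.sliceSup_mul_image_fst_le hm
  rw [hA1, one_mul] at hp
  -- Bounds pass from one set to the other by `sliceSup_mul_le`, at the cost of a factor `m / M`
  -- below and `M / m` above.
  have key : ∀ A B : Set (ℝ × ℝ), NearEquality m M δ A B →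
      sliceSup A ∈ Set.Icc (min 1 c) (max 1 (M ^ 2 / m)) →
      sliceSup A ∈ Set.Icc κ Λ ∧ sliceSup B ∈ Set.Icc κ Λ := by
    intro A B h hA
    have h1 := h.sliceSup_mul_le hm
    have h2 := h.symm.sliceSup_mul_le hm
    refine ⟨⟨le_trans ?_ hA.1, hA.2.trans ?_⟩, ?_, ?_⟩
    · exact mul_le_of_le_one_right hc1.le hmM
    · exact le_mul_of_one_le_right hC1.le hMm
    · rw [hκ, mul_div_assoc', div_le_iff₀ hM0]
      have : min 1 c * m ≤ sliceSup A * m := mul_le_mul_of_nonneg_right hA.1 hm.le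
      linarith
    · rw [hΛ, mul_div_assoc', le_div_iff₀ hm]
      have : sliceSup A * M ≤ max 1 (M ^ 2 / m) * M := mul_le_mul_of_nonneg_right hA.2 hM0.le
      linarith
  have k1 := key A B h ⟨by rw [hA1]; exact min_le_left _ _, by rw [hA1]; exact le_max_left _ _⟩
  have k2 := key _ _ (h.image (measurePreserving_slant 0))
    ⟨(min_le_right _ _).trans hlow, (hup.trans hp).trans (le_max_right _ _)⟩
  exact ⟨⟨k1.1, k2.1⟩, k1.2, k2.2⟩

end NearEquality

open scoped symmDiff

/-! ### Approximation by unions of grid squares. -/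

/-- The `i`-th cell of the grid of mesh `r` on the half-line. -/
def cell (r : ℝ) (i : ℕ) : Set ℝ := Set.Ico (i * r) ((i + 1) * r)

/-- The union of the cells with index in `T`. -/
def cellUnion (r : ℝ) (T : Finset ℕ) : Set ℝ := ⋃ i ∈ T, cell r i

/-- The indices of the cells at least half of which is covered by `L`. -/
noncomputable def majority (r : ℝ) (n : ℕ) (L : Set ℝ) : Finset ℕ :=
  open Classical in
  (Finset.range n).filter fun i => ENNReal.ofReal (r / 2) ≤ volume (L ∩ cell r i)

section

variable {r : ℝ} {n : ℕ}

theorem mem_majority {L : Set ℝ} {i : ℕ} :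
    i ∈ majority r n L ↔ i < n ∧ ENNReal.ofReal (r / 2) ≤ volume (L ∩ cell r i) := by
  simp [majority]

theorem measurableSet_cell (i : ℕ) : MeasurableSet (cell r i) := measurableSet_Ico

theorem measurableSet_cellUnion (T : Finset ℕ) : MeasurableSet (cellUnion r T) :=
  T.measurableSet_biUnion fun i _ => measurableSet_cell i

theorem volume_cell (i : ℕ) : volume (cell r i) = ENNReal.ofReal r := by
  rw [cell, Real.volume_Ico]
  congr 1
  ring

theorem cell_index_unique (hr : 0 < r) {i j : ℕ} {x : ℝ} (hi : x ∈ cell r i) (hj : x ∈ cell r j) :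
    i = j := by
  have h1 := lt_of_mul_lt_mul_right (hi.1.trans_lt hj.2) hr.le
  have h2 := lt_of_mul_lt_mul_right (hj.1.trans_lt hi.2) hr.le
  have h3 : i < j + 1 := by exact_mod_cast h1
  have h4 : j < i + 1 := by exact_mod_cast h2
  omega

theorem mem_cellUnion_iff (hr : 0 < r) {T : Finset ℕ} {i : ℕ} {x : ℝ} (hi : x ∈ cell r i) :
    x ∈ cellUnion r T ↔ i ∈ T := by
  simp only [cellUnion, Set.mem_iUnion]
  constructor
  · rintro ⟨j, hj, hx⟩
    rwa [cell_index_unique hr hi hx]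
  · exact fun h => ⟨i, h, hi⟩

theorem cellUnion_range (hr : 0 < r) (n : ℕ) :
    cellUnion r (Finset.range n) = Set.Ico 0 (n * r) := by
  ext x
  simp only [cellUnion, Set.mem_iUnion, Finset.mem_range]
  constructor
  · rintro ⟨i, hi, hx⟩
    refine ⟨(by positivity : (0 : ℝ) ≤ i * r).trans hx.1, hx.2.trans_le ?_⟩
    have : (i : ℝ) + 1 ≤ n := by exact_mod_cast hi
    gcongr
  · rintro ⟨h0, h1⟩
    have hb := floor_cell_bounds hr h0
    refine ⟨⌊x / r⌋₊, ?_, hb⟩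
    have : (⌊x / r⌋₊ : ℝ) < n := lt_of_mul_lt_mul_right (hb.1.trans_lt h1) hr.le
    exact_mod_cast this

theorem symmDiff_cellUnion_inter_cell (hr : 0 < r) (L : Set ℝ) (T : Finset ℕ) (i : ℕ) :
    (i ∈ T → (L ∆ cellUnion r T) ∩ cell r i = cell r i \ L) ∧
    (i ∉ T → (L ∆ cellUnion r T) ∩ cell r i = L ∩ cell r i) := by
  constructor <;> intro hi <;> ext x <;> constructor
  · rintro ⟨h, hx⟩
    have := (mem_cellUnion_iff hr (T := T) hx).2 hi
    rcases h with h | h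
    · exact absurd this h.2
    · exact ⟨hx, h.2⟩
  · rintro ⟨hx, h⟩
    exact ⟨Or.inr ⟨(mem_cellUnion_iff hr hx).2 hi, h⟩, hx⟩
  · rintro ⟨h, hx⟩
    have := mt (mem_cellUnion_iff hr (T := T) hx).1 hi
    rcases h with h | h
    · exact ⟨h.1, hx⟩
    · exact absurd h.1 this
  · rintro ⟨h, hx⟩
    exact ⟨Or.inl ⟨h, mt (mem_cellUnion_iff hr hx).1 hi⟩, hx⟩

theorem volume_inter_Ico_eq_sum (hr : 0 < r) {S : Set ℝ} (hS : MeasurableSet S) (n : ℕ) :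
    volume (S ∩ Set.Ico 0 (n * r)) = ∑ i ∈ Finset.range n, volume (S ∩ cell r i) := by
  rw [← cellUnion_range hr, cellUnion, Set.inter_iUnion₂, measure_biUnion_finset]
  · intro i _ j _ hij
    refine Set.disjoint_left.2 fun x hx hx' => hij (cell_index_unique hr hx.2 hx'.2)
  · exact fun i _ => hS.inter (measurableSet_cell i)

/-- The majority rule gives the best approximation by a union of cells. -/
theorem volume_symmDiff_majority_le (hr : 0 < r) {L : Set ℝ} (hL : MeasurableSet L)
    (T : Finset ℕ) :
    volume ((L ∆ cellUnion r (majority r n L)) ∩ Set.Ico 0 (n * r)) ≤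
      volume ((L ∆ cellUnion r T) ∩ Set.Ico 0 (n * r)) := by
  have hm : ∀ T, MeasurableSet (L ∆ cellUnion r T) := fun T =>
    hL.symmDiff (measurableSet_cellUnion T)
  rw [volume_inter_Ico_eq_sum hr (hm _), volume_inter_Ico_eq_sum hr (hm _)]
  refine Finset.sum_le_sum fun i hi => ?_
  have h1 := symmDiff_cellUnion_inter_cell hr L (majority r n L) i
  have h2 := symmDiff_cellUnion_inter_cell hr L T i
  have hsum : volume (L ∩ cell r i) + volume (cell r i \ L) = ENNReal.ofReal (r / 2) +
      ENNReal.ofReal (r / 2) := by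
    rw [Set.inter_comm, measure_inter_add_sdiff _ hL, volume_cell,
      ← ENNReal.ofReal_add (by positivity) (by positivity), add_halves]
  by_cases him : i ∈ majority r n L
  · have h3 := (mem_majority.1 him).2
    rw [h1.1 him]
    by_cases hiT : i ∈ T
    · rw [h2.1 hiT]
    · rw [h2.2 hiT]
      refine le_trans ?_ h3
      by_contra! hlt
      exact absurd hsum (ENNReal.add_lt_add_of_le_of_lt ENNReal.ofReal_ne_top h3 hlt).ne'
  · have h3 : volume (L ∩ cell r i) < ENNReal.ofReal (r / 2) := by
      by_contra! hle
      exact him (mem_majority.2 ⟨Finset.mem_range.1 hi, hle⟩)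
    rw [h1.2 him]
    by_cases hiT : i ∈ T
    · rw [h2.1 hiT]
      refine h3.le.trans ?_
      by_contra! hlt
      exact absurd hsum (ENNReal.add_lt_add h3 hlt).ne
    · rw [h2.2 hiT]

theorem symmDiff_inter_subset {α : Type*} (a b c s : Set α) :
    (a ∆ c) ∩ s ⊆ ((a ∆ b) ∩ s) ∪ ((b ∆ c) ∩ s) := by
  rw [← Set.union_inter_distrib_right]
  exact Set.inter_subset_inter_left _ (symmDiff_triangle a b c)

theorem NearInterval.volume_symmDiff_majority_le (hr : 0 < r) {L : Set ℝ} {η : ℝ}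
    (h : NearInterval L η) (hη : 0 ≤ η) (hL : IsCompact L) :
    volume ((L ∆ cellUnion r (majority r n L)) ∩ Set.Ico 0 (n * r)) ≤
      ENNReal.ofReal (5 * η + 2 * r) := by
  classical
  obtain ⟨p, q, hpq, h1, h2⟩ := h
  -- The cells inside `[p, q]` miss at most a length `r` at each end. The majority rule does at
  -- least as well as this choice for approximating `L`.
  set T := (Finset.range n).filter fun i => cell r i ⊆ Set.Icc p q with hT
  have hI : (Set.Icc p q ∆ cellUnion r T) ∩ Set.Ico 0 (n * r) ⊆
      Set.Icc p (p + r) ∪ Set.Icc (q - r) q := by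
    rintro x ⟨hx, hxn⟩
    rw [← cellUnion_range hr] at hxn
    simp only [cellUnion, Set.mem_iUnion] at hxn
    obtain ⟨i, hi, hxi⟩ := hxn
    rcases hx with ⟨hxI, hxT⟩ | ⟨hxT, hxI⟩
    · rw [mem_cellUnion_iff hr hxi] at hxT
      have hns : ¬ cell r i ⊆ Set.Icc p q := fun hs => hxT (Finset.mem_filter.2 ⟨hi, hs⟩)
      obtain ⟨y, hy, hyI⟩ := Set.not_subset.1 hns
      by_cases hyp : p ≤ y
      · have hyq : q < y := by
          by_contra! hle
          exact hyI ⟨hyp, hle⟩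
        refine Or.inr ⟨?_, hxI.2⟩
        linarith [hy.2, hxi.1]
      · refine Or.inl ⟨hxI.1, ?_⟩
        linarith [hy.1, hxi.2]
    · rw [mem_cellUnion_iff hr hxi] at hxT
      exact absurd ((Finset.mem_filter.1 hxT).2 hxi) hxI
  have hI' : volume ((Set.Icc p q ∆ cellUnion r T) ∩ Set.Ico 0 (n * r)) ≤
      ENNReal.ofReal (2 * r) := by
    refine (measure_mono hI).trans ((measure_union_le _ _).trans ?_)
    rw [Real.volume_Icc, Real.volume_Icc, ← ENNReal.ofReal_add (by linarith) (by linarith)]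
    exact ENNReal.ofReal_le_ofReal (by linarith)
  -- At most `2 * η` of `L` lies outside the interval, so at most `3 * η` of the interval lies
  -- outside `L`.
  have hLI : volume ((L ∆ Set.Icc p q) ∩ Set.Ico 0 (n * r)) ≤ ENNReal.ofReal (5 * η) := by
    refine (measure_mono Set.inter_subset_left).trans ?_
    have hd := measureReal_symmDiff_eq (μ := volume) (s := L) (t := Set.Icc p q) hL.measurableSet
      measurableSet_Icc hL.measure_ne_top (by simp)
    have hI1 := measureReal_inter_add_sdiff (μ := volume) (s := Set.Icc p q) hL.measurableSet
      (by simp)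
    have hL1 := measureReal_inter_add_sdiff (μ := volume) (s := L) (measurableSet_Icc (a := p)
      (b := q)) hL.measure_ne_top
    rw [Real.volume_real_Icc_of_le hpq, Set.inter_comm] at hI1
    have hfin : volume (L ∆ Set.Icc p q) ≠ ∞ :=
      ((measure_mono symmDiff_le_sup).trans_lt
        (measure_union_lt_top hL.measure_lt_top (by simp : volume (Set.Icc p q) < ∞))).ne
    rw [← ofReal_measureReal hfin]
    refine ENNReal.ofReal_le_ofReal ?_
    linarith
  calc _ ≤ volume ((L ∆ cellUnion r T) ∩ Set.Ico 0 (n * r)) :=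
        _root_.volume_symmDiff_majority_le hr hL.measurableSet T
    _ ≤ _ := (measure_mono (symmDiff_inter_subset _ (Set.Icc p q) _ _)).trans
        ((measure_union_le _ _).trans (add_le_add hLI hI'))
    _ = _ := by rw [← ENNReal.ofReal_add (by positivity) (by positivity)]

/-- The union of the grid squares with indices in `T`. -/
def gridSet (r : ℝ) (T : Finset (ℕ × ℕ)) : Set (ℝ × ℝ) := ⋃ z ∈ T, cell r z.1 ×ˢ cell r z.2

theorem measurableSet_gridSet (T : Finset (ℕ × ℕ)) : MeasurableSet (gridSet r T) :=
  T.measurableSet_biUnion fun _ _ => (measurableSet_cell _).prod (measurableSet_cell _)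

theorem volume_gridSet_ne_top (T : Finset (ℕ × ℕ)) : volume (gridSet r T) ≠ ∞ := by
  refine ((measure_biUnion_finset_le _ _).trans_lt (ENNReal.sum_lt_top.2 fun z _ => ?_)).ne
  rw [Measure.volume_eq_prod, Measure.prod_prod, volume_cell, volume_cell]
  exact ENNReal.mul_lt_top ENNReal.ofReal_lt_top ENNReal.ofReal_lt_top

theorem SlicesNearInterval.lintegral_majority_le (hr : 0 < r) {E : Set (ℝ × ℝ)} {η : ℝ}
    (hη : 0 ≤ η) (hE : IsCompact E) (h : SlicesNearInterval η E) :
    ∫⁻ x in Set.Ico 0 (n * r),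
      volume ((slice E x ∆ cellUnion r (majority r n (slice E x))) ∩ Set.Ico 0 (n * r)) ≤
      ENNReal.ofReal (n * r * (6 * η + 2 * r)) := by
  obtain ⟨N, hN, hNf, hNη, hNI⟩ := h
  have hnr : 0 ≤ n * r := by positivity
  have hpt : ∀ x, volume ((slice E x ∆ cellUnion r (majority r n (slice E x))) ∩
      Set.Ico 0 (n * r)) ≤ ENNReal.ofReal (5 * η + 2 * r) +
        N.indicator (fun _ => ENNReal.ofReal (n * r)) x := by
    intro x
    by_cases hx : x ∈ N
    · rw [Set.indicator_of_mem hx]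
      refine le_add_left ((measure_mono Set.inter_subset_right).trans ?_)
      rw [Real.volume_Ico, sub_zero]
    · rw [Set.indicator_of_notMem hx, add_zero]
      exact (hNI x hx).volume_symmDiff_majority_le hr hη (hE.slice x)
  calc _ ≤ ∫⁻ x in Set.Ico 0 (n * r), (ENNReal.ofReal (5 * η + 2 * r) +
          N.indicator (fun _ => ENNReal.ofReal (n * r)) x) := lintegral_mono hpt
    _ ≤ ENNReal.ofReal (5 * η + 2 * r) * ENNReal.ofReal (n * r) +
        ∫⁻ x, N.indicator (fun _ => ENNReal.ofReal (n * r)) x := by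
      rw [lintegral_add_left measurable_const, setLIntegral_const, Real.volume_Ico, sub_zero]
      gcongr
      exact Measure.restrict_le_self
    _ ≤ ENNReal.ofReal (5 * η + 2 * r) * ENNReal.ofReal (n * r) +
        ENNReal.ofReal (n * r) * ENNReal.ofReal η := by
      rw [lintegral_indicator_const hN, ← ofReal_measureReal hNf]
      gcongr
    _ = _ := by
      rw [← ENNReal.ofReal_mul (by positivity), ← ENNReal.ofReal_mul hnr,
        ← ENNReal.ofReal_add (by positivity) (by positivity)]
      congr 1
      ring

theorem volume_inter_square_eq {S : Set (ℝ × ℝ)} (hS : MeasurableSet S) (c : ℝ) :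
    volume (S ∩ Set.Ico 0 c ×ˢ Set.Ico 0 c) =
      ∫⁻ x in Set.Ico 0 c, volume (slice S x ∩ Set.Ico 0 c) := by
  rw [Measure.volume_eq_prod, Measure.prod_apply
    (hS.inter (measurableSet_Ico.prod measurableSet_Ico)), ← lintegral_indicator measurableSet_Ico]
  refine lintegral_congr fun x => ?_
  by_cases hx : x ∈ Set.Ico 0 c
  · rw [Set.indicator_of_mem hx]
    congr 1
    ext y
    exact ⟨fun h => ⟨h.1, h.2.2⟩, fun h => ⟨h.1, hx, h.2⟩⟩
  · rw [Set.indicator_of_notMem hx]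
    exact measure_mono_null (t := ∅) (fun y hy => hx hy.2.1) (by simp)

theorem slice_symmDiff (S S' : Set (ℝ × ℝ)) (x : ℝ) :
    slice (S ∆ S') x = slice S x ∆ slice S' x := rfl

theorem mem_slice_slant_zero {S : Set (ℝ × ℝ)} {x y : ℝ} :
    x ∈ slice (slant 0 '' S) y ↔ (x, y) ∈ S := by
  rw [mem_slice_slant]
  simp

theorem volume_inter_square_slant {S : Set (ℝ × ℝ)} (c : ℝ) :
    volume (slant 0 '' S ∩ Set.Ico 0 c ×ˢ Set.Ico 0 c) =
      volume (S ∩ Set.Ico 0 c ×ˢ Set.Ico 0 c) := by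
  have h : MeasurePreserving (slant 0).toHomeomorph.toMeasurableEquiv volume volume :=
    measurePreserving_slant 0
  have h1 := h.measure_preimage_equiv (slant 0 '' S ∩ Set.Ico 0 c ×ˢ Set.Ico 0 c)
  rw [← h1]
  congr 1
  ext ⟨x, y⟩
  change slant 0 (x, y) ∈ slant 0 '' S ∩ Set.Ico 0 c ×ˢ Set.Ico 0 c ↔ _
  rw [Set.mem_inter_iff, Set.mem_inter_iff, slant_apply]
  have : ((x, y).2 - 0 * (x, y).1, (x, y).1) ∈ slant 0 '' S ↔ (x, y) ∈ S := by
    rw [← mem_slice, mem_slice_slant_zero]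
    simp
  rw [this]
  simp only [Set.mem_prod]
  constructor <;> rintro ⟨h1, h2, h3⟩
  · exact ⟨h1, h3, by simpa using h2⟩
  · exact ⟨h1, by simpa using h3, h2⟩

/-- A set whose horizontal and vertical slices are close to intervals is close to a union of grid
squares. -/
theorem exists_gridSet_approx (hr : 0 < r) (n : ℕ) {E : Set (ℝ × ℝ)} {η : ℝ} (hη : 0 ≤ η)
    (hE : IsCompact E) (h : SlicesNearInterval η E) (h' : SlicesNearInterval η (slant 0 '' E)) :
    ∃ T ⊆ Finset.range n ×ˢ Finset.range n, volume (E ∆ gridSet r T) ≤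
      volume (E \ Set.Ico 0 (n * r) ×ˢ Set.Ico 0 (n * r)) +
        ENNReal.ofReal (3 * (n * r * (6 * η + 2 * r))) := by
  classical
  set c := n * r with hc
  set e := n * r * (6 * η + 2 * r) with he
  have he0 : 0 ≤ e := by positivity
  have hEm := hE.measurableSet
  set X : ℕ → Set ℝ := fun j => {x | ENNReal.ofReal (r / 2) ≤ volume (slice E x ∩ cell r j)} with hX
  have hXm : ∀ j, MeasurableSet (X j) := fun j => by
    have h1 : MeasurableSet (E ∩ Prod.snd ⁻¹' cell r j) :=
      hEm.inter (measurable_snd (measurableSet_cell j))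
    exact measurableSet_le measurable_const (measurable_measure_prodMk_left h1)
  -- Rounding every vertical slice of `E` to its majority cells makes the horizontal slice constant,
  -- equal to `X j`, throughout the row `j`. Rounding each `X j` in turn produces grid squares.
  set E1 : Set (ℝ × ℝ) := ⋃ j ∈ Finset.range n, X j ×ˢ cell r j with hE1
  have hE1m : MeasurableSet E1 :=
    Finset.measurableSet_biUnion _ fun j _ => (hXm j).prod (measurableSet_cell j)
  have hE1s : ∀ x, slice E1 x = cellUnion r (majority r n (slice E x)) := by
    intro x
    ext y
    rw [mem_slice]
    simp only [hE1, cellUnion, Set.mem_iUnion, Set.mem_prod, Finset.mem_range, mem_majority]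
    constructor
    · rintro ⟨j, hj, hx, hy⟩
      exact ⟨j, ⟨hj, hx⟩, hy⟩
    · rintro ⟨j, ⟨hj, hx⟩, hy⟩
      exact ⟨j, hj, hx, hy⟩
  set T := (Finset.range n ×ˢ Finset.range n).filter fun z => z.1 ∈ majority r n (X z.2) with hT
  set G := gridSet r T with hG
  have hGm : MeasurableSet G := measurableSet_gridSet T
  have hGQ : G ⊆ Set.Ico 0 c ×ˢ Set.Ico 0 c := by
    intro p hp
    simp only [hG, gridSet, Set.mem_iUnion] at hp
    obtain ⟨z, hz, h1, h2⟩ := hp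
    have hz' := Finset.mem_product.1 (Finset.mem_filter.1 hz).1
    rw [hc, ← cellUnion_range hr]
    exact ⟨(mem_cellUnion_iff hr h1).2 hz'.1, (mem_cellUnion_iff hr h2).2 hz'.2⟩
  have hslE1 : ∀ j < n, ∀ y ∈ cell r j, slice (slant 0 '' E1) y = X j := by
    intro j hj y hy
    ext x
    rw [mem_slice_slant_zero]
    simp only [hE1, Set.mem_iUnion, Set.mem_prod, Finset.mem_range]
    constructor
    · rintro ⟨i, hi, hx, hyi⟩
      rwa [cell_index_unique hr hy hyi]
    · exact fun hx => ⟨j, hj, hx, hy⟩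
  have hslG : ∀ j < n, ∀ y ∈ cell r j, slice (slant 0 '' G) y =
      cellUnion r (majority r n (X j)) := by
    intro j hj y hy
    ext x
    rw [mem_slice_slant_zero]
    simp only [hG, gridSet, hT, Set.mem_iUnion, Set.mem_prod, cellUnion]
    constructor
    · rintro ⟨z, hz, hx, hyi⟩
      obtain rfl := cell_index_unique hr hy hyi
      exact ⟨z.1, (Finset.mem_filter.1 hz).2, hx⟩
    · rintro ⟨i, hi, hx⟩
      exact ⟨(i, j), Finset.mem_filter.2 ⟨Finset.mem_product.2
        ⟨Finset.mem_range.2 (mem_majority.1 hi).1, Finset.mem_range.2 hj⟩, hi⟩, hx, hy⟩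
  have hstep1 : volume ((E ∆ E1) ∩ Set.Ico 0 c ×ˢ Set.Ico 0 c) ≤ ENNReal.ofReal e := by
    rw [volume_inter_square_eq (hEm.symmDiff hE1m)]
    simp only [slice_symmDiff, hE1s]
    exact h.lintegral_majority_le hr hη hE
  have himg : ∀ S S' : Set (ℝ × ℝ), slant 0 '' (S ∆ S') = (slant 0 '' S) ∆ (slant 0 '' S') :=
    fun S S' => Set.image_symmDiff (slant 0).injective S S'
  have hsm : ∀ S : Set (ℝ × ℝ), MeasurableSet S → MeasurableSet (slant 0 '' S) := fun S hS =>
    (slant 0).toHomeomorph.toMeasurableEquiv.measurableSet_image.2 hS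
  have hstep2 : volume ((E1 ∆ G) ∩ Set.Ico 0 c ×ˢ Set.Ico 0 c) ≤
      volume ((E1 ∆ E) ∩ Set.Ico 0 c ×ˢ Set.Ico 0 c) + ENNReal.ofReal e := by
    have hm1 : MeasurableSet ((slant 0 '' E1) ∆ (slant 0 '' E)) := (hsm _ hE1m).symmDiff (hsm _ hEm)
    rw [← volume_inter_square_slant, himg,
      volume_inter_square_eq ((hsm _ hE1m).symmDiff (hsm _ hGm)),
      ← volume_inter_square_slant (S := E1 ∆ E), himg, volume_inter_square_eq hm1]
    refine le_trans ?_ (add_le_add_right (h'.lintegral_majority_le (n := n) hr hη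
      (hE.image (slant 0).continuous)) _)
    have hmeas : Measurable fun y => volume (slice ((slant 0 '' E1) ∆ (slant 0 '' E)) y ∩
        Set.Ico 0 c) :=
      measurable_measure_prodMk_left (hm1.inter (measurable_snd measurableSet_Ico))
    rw [← lintegral_add_left hmeas]
    refine setLIntegral_mono' measurableSet_Ico fun y hy => ?_
    rw [hc, ← cellUnion_range hr] at hy
    simp only [cellUnion, Set.mem_iUnion, Finset.mem_range] at hy
    obtain ⟨j, hj, hy⟩ := hy
    rw [slice_symmDiff, slice_symmDiff, hslE1 j hj y hy, hslG j hj y hy]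
    -- `X j` itself is not known to be near an interval. Optimality of its majority cells allows
    -- comparison with those of the slice of `E`, which is near an interval for most `y`.
    refine (volume_symmDiff_majority_le hr (hXm j)
      (majority r n (slice (slant 0 '' E) y))).trans ?_
    exact (measure_mono (symmDiff_inter_subset _ (slice (slant 0 '' E) y) _ _)).trans
      (measure_union_le _ _)
  refine ⟨T, Finset.filter_subset _ _, ?_⟩
  have hsub : E ∆ G ⊆ (E \ Set.Ico 0 c ×ˢ Set.Ico 0 c) ∪
      ((E ∆ G) ∩ Set.Ico 0 c ×ˢ Set.Ico 0 c) := by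
    intro p hp
    by_cases hpQ : p ∈ Set.Ico 0 c ×ˢ Set.Ico 0 c
    · exact Or.inr ⟨hp, hpQ⟩
    · rcases hp with hp | hp
      · exact Or.inl ⟨hp.1, hpQ⟩
      · exact absurd (hGQ hp.1) hpQ
  refine (measure_mono hsub).trans ((measure_union_le _ _).trans ?_)
  gcongr
  refine (measure_mono (symmDiff_inter_subset _ E1 _ _)).trans ((measure_union_le _ _).trans ?_)
  rw [symmDiff_comm E1 E] at hstep2
  calc _ ≤ ENNReal.ofReal e + (ENNReal.ofReal e + ENNReal.ofReal e) :=
        add_le_add hstep1 (hstep2.trans (add_le_add_left hstep1 _))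
    _ = _ := by
      rw [← ENNReal.ofReal_add he0 he0, ← ENNReal.ofReal_add he0 (by positivity)]
      congr 1
      ring

end

/-! ### Finite approximability and precompactness. -/

/-- A sequence of sets is finitely approximable if, for every `ε > 0`, almost all of its terms lie
within measure `ε` of one of finitely many measurable sets of finite measure. -/
def FinitelyApproximable {α : Type*} [MeasurableSpace α] (μ : Measure α) (E : ℕ → Set α) : Prop :=
  ∀ ε : ℝ, 0 < ε → ∃ G : Set (Set α), G.Finite ∧ (∀ S ∈ G, MeasurableSet S ∧ μ S ≠ ∞) ∧
    ∀ᶠ n in atTop, ∃ S ∈ G, μ (E n ∆ S) ≤ ENNReal.ofReal ε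

theorem FinitelyApproximable.of_image {α β : Type*} [MeasurableSpace α] [MeasurableSpace β]
    {μ : Measure α} {ν : Measure β} (θ : α ≃ᵐ β) {c : ℝ} (hc : 0 < c)
    (hθ : ∀ S, ν (θ '' S) = ENNReal.ofReal c * μ S) {E : ℕ → Set α}
    (h : FinitelyApproximable ν fun n => θ '' E n) : FinitelyApproximable μ E := by
  intro ε hε
  have hc' : ENNReal.ofReal c ≠ 0 := by simpa using hc
  obtain ⟨G, hG, hGm, hGn⟩ := h (c * ε) (by positivity)
  refine ⟨(fun S => θ ⁻¹' S) '' G, hG.image _, ?_, ?_⟩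
  · rintro _ ⟨S, hS, rfl⟩
    refine ⟨θ.measurable (hGm S hS).1, ?_⟩
    have h1 := hθ (θ ⁻¹' S)
    rw [Set.image_preimage_eq _ θ.surjective] at h1
    intro htop
    rw [htop, ENNReal.mul_top hc'] at h1
    exact (hGm S hS).2 h1
  · filter_upwards [hGn] with n hn
    obtain ⟨S, hS, hSn⟩ := hn
    refine ⟨_, ⟨S, hS, rfl⟩, ?_⟩
    have h1 := hθ (E n ∆ (θ ⁻¹' S))
    rw [Set.image_symmDiff θ.injective, Set.image_preimage_eq _ θ.surjective] at h1
    rw [h1, ENNReal.ofReal_mul hc.le] at hSn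
    exact (ENNReal.mul_le_mul_iff_right hc' ENNReal.ofReal_ne_top).1 hSn

theorem FinitelyApproximable.congr_of_tendsto {α : Type*} [MeasurableSpace α] {μ : Measure α}
    {E F : ℕ → Set α} (h : FinitelyApproximable μ E)
    (hEF : Tendsto (fun n => μ (F n ∆ E n)) atTop (𝓝 0)) : FinitelyApproximable μ F := by
  intro ε hε
  obtain ⟨G, hG, hGm, hGn⟩ := h (ε / 2) (by positivity)
  refine ⟨G, hG, hGm, ?_⟩
  filter_upwards [hGn, hEF.eventually_le_const
    (show 0 < ENNReal.ofReal (ε / 2) by simpa using hε)] with n ⟨S, hS, hn⟩ hn'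
  refine ⟨S, hS, (measure_symmDiff_le _ (E n) _).trans ((add_le_add hn' hn).trans_eq ?_)⟩
  rw [← ENNReal.ofReal_add (by positivity) (by positivity), add_halves]

theorem memLp_indicatorFun {E : Set Plane} (hE : NullMeasurableSet E (volume : Measure Plane))
    (hfin : volume E ≠ ∞) : MemLp (indicatorFun E) 2 (volume : Measure Plane) := by
  obtain ⟨F, -, hF, hFE⟩ := hE.exists_measurable_subset_ae_eq
  have h1 : MemLp (F.indicator fun _ => (1 : ℝ)) 2 (volume : Measure Plane) :=
    memLp_indicator_const 2 hF 1 (Or.inr (by rwa [measure_congr hFE]))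
  exact h1.ae_eq (indicator_ae_eq_of_ae_eq_set hFE)

theorem eLpNorm_indicatorFun_sub_le (E F : Set Plane) :
    eLpNorm (indicatorFun E - indicatorFun F) 2 (volume : Measure Plane) ≤
      volume (E ∆ F) ^ (1 / 2 : ℝ) := by
  have h1 : eLpNorm (indicatorFun E - indicatorFun F) 2 (volume : Measure Plane) ≤
      eLpNorm ((E ∆ F).indicator fun _ => (1 : ℝ)) 2 (volume : Measure Plane) := by
    refine eLpNorm_mono fun x => ?_
    by_cases hE : x ∈ E <;> by_cases hF : x ∈ F <;>
      simp [indicatorFun, Set.mem_symmDiff, hE, hF]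
  refine h1.trans ((eLpNorm_indicator_const_le _ _).trans ?_)
  simp

/-- The $L^2$ distance of two indicators is at most the square root of the measure of the symmetric
difference, so the approximants and the finitely many initial terms form a finite net. -/
theorem FinitelyApproximable.precompactInL2 {E : ℕ → Set Plane}
    (h : FinitelyApproximable (volume : Measure Plane) E)
    (hE : ∀ n, NullMeasurableSet (E n) (volume : Measure Plane))
    (hfin : ∀ n, volume (E n) ≠ ∞) : PrecompactInL2 fun n => indicatorFun (E n) := by
  classical
  refine ⟨fun n => memLp_indicatorFun (hE n) (hfin n), TotallyBounded.isCompact_of_isClosed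
    (TotallyBounded.closure ?_) isClosed_closure⟩
  rw [EMetric.totallyBounded_iff]
  intro ε hε
  obtain ⟨ρ, hρ0, hρ⟩ := ENNReal.lt_iff_exists_real_btwn.1 hε
  have hρp : 0 < ρ := by simpa using hρ.1
  obtain ⟨G, hG, hGm, hGn⟩ := h (ρ ^ 2) (by positivity)
  obtain ⟨N, hN⟩ := eventually_atTop.1 hGn
  set f : ℕ → Lp ℝ 2 (volume : Measure Plane) := fun n =>
    (memLp_indicatorFun (hE n) (hfin n)).toLp (indicatorFun (E n)) with hf
  set g : Set Plane → Lp ℝ 2 (volume : Measure Plane) := fun S =>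
    if hS : MemLp (indicatorFun S) 2 (volume : Measure Plane) then hS.toLp _ else 0 with hg
  refine ⟨f '' Set.Iio N ∪ g '' G, ((Set.finite_Iio N).image f).union (hG.image g), ?_⟩
  rintro _ ⟨n, rfl⟩
  rw [Set.mem_iUnion₂]
  rcases lt_or_ge n N with hn | hn
  · exact ⟨f n, Or.inl ⟨n, hn, rfl⟩, by simpa [hf] using hε⟩
  · obtain ⟨S, hS, hSn⟩ := hN n hn
    refine ⟨g S, Or.inr ⟨S, hS, rfl⟩, ?_⟩
    have hSm : MemLp (indicatorFun S) 2 (volume : Measure Plane) :=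
      memLp_indicatorFun (hGm S hS).1.nullMeasurableSet (hGm S hS).2
    have hgS : g S = hSm.toLp _ := dif_pos hSm
    rw [hgS, Metric.mem_eball, Lp.edist_toLp_toLp]
    refine (eLpNorm_indicatorFun_sub_le _ _).trans_lt (lt_of_le_of_lt ?_ hρ.2)
    calc _ ≤ ENNReal.ofReal (ρ ^ 2) ^ (1 / 2 : ℝ) := by gcongr
      _ = ENNReal.ofReal ρ := by
        rw [ENNReal.ofReal_rpow_of_nonneg (by positivity) (by norm_num), ← Real.sqrt_eq_rpow,
          Real.sqrt_sq hρp.le]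

/-- The translation must not depend on the accuracy, so it is fixed by a box `z` missing at most a
third of the mass. The box for a finer `η` also misses at most a third, so it meets the first one
and stays in a fixed square after translation. -/
theorem exists_finitelyApproximable_translates {E : ℕ → Set (ℝ × ℝ)} {R m : ℝ} (hR : 0 < R)
    (hm : 0 < m) (h : ∀ η > 0, ∀ᶠ n in atTop, IsCompact (E n) ∧ m ≤ volume.real (E n) ∧
      SlicesNearInterval η (E n) ∧ SlicesNearInterval η (slant 0 '' E n) ∧
      ∃ u v : ℝ, volume.real (E n \ Set.Icc u (u + R) ×ˢ Set.Icc v (v + R)) ≤ η) :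
    ∃ w : ℕ → ℝ × ℝ, FinitelyApproximable volume fun n => (fun p => p + w n) '' E n := by
  classical
  have hm3 : 0 < m / 3 := by positivity
  have hbox : ∀ n, ∃ z : ℝ × ℝ, (∃ u v : ℝ,
      volume.real (E n \ Set.Icc u (u + R) ×ˢ Set.Icc v (v + R)) ≤ m / 3) →
      volume.real (E n \ Set.Icc z.1 (z.1 + R) ×ˢ Set.Icc z.2 (z.2 + R)) ≤ m / 3 := by
    intro n
    by_cases hz : ∃ u v : ℝ, volume.real (E n \ Set.Icc u (u + R) ×ˢ Set.Icc v (v + R)) ≤ m / 3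
    · obtain ⟨u, v, huv⟩ := hz
      exact ⟨(u, v), fun _ => huv⟩
    · exact ⟨0, fun h => absurd h hz⟩
  choose z hz using hbox
  refine ⟨fun n => (R - (z n).1, R - (z n).2), fun ε hε => ?_⟩
  -- The translated coarse box is $[R,2R]^2$, and a box of side `R` meeting it lies in $[0,3R]^2$;
  -- the `+ 1` accommodates half-open cells.
  set c := 3 * R + 1 with hc
  have hc0 : 0 < c := by positivity
  -- The total error is $\eta+3c(6\eta+2r)=\eta(1+18c)+6cr$; `η` and `k` give each part half of `ε`.
  set η := min (m / 3) (ε / (2 * (1 + 18 * c))) with hη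
  have hη0 : 0 < η := by positivity
  have hηm : η ≤ m / 3 := min_le_left _ _
  have hηε : η * (1 + 18 * c) ≤ ε / 2 := by
    have : η ≤ ε / (2 * (1 + 18 * c)) := min_le_right _ _
    rw [le_div_iff₀ (by positivity)] at this
    linarith
  obtain ⟨k, hk⟩ := exists_nat_gt (12 * c * c / ε)
  have hk0 : (0 : ℝ) < k := (by positivity : (0 : ℝ) < 12 * c * c / ε).trans hk
  set r := c / k with hr
  have hr0 : 0 < r := by positivity
  have hkr : k * r = c := by rw [hr]; field_simp
  have hrε : 6 * c * r ≤ ε / 2 := by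
    rw [div_lt_iff₀ hε] at hk
    rw [hr, mul_div_assoc', div_le_iff₀ hk0]
    linarith
  refine ⟨(fun T => gridSet r T) '' ((Finset.range k ×ˢ Finset.range k).powerset : Set _),
    (Finset.finite_toSet _).image _, ?_, ?_⟩
  · rintro _ ⟨T, -, rfl⟩
    exact ⟨measurableSet_gridSet T, volume_gridSet_ne_top T⟩
  filter_upwards [h (m / 3) hm3, h η hη0] with n hn1 hn2
  have hz1 := hz n hn1.2.2.2.2
  obtain ⟨hEc, hEm, hs1, hs2, u, v, huv⟩ := hn2
  set w : ℝ × ℝ := (R - (z n).1, R - (z n).2) with hw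
  have hs2' : SlicesNearInterval η (slant 0 '' ((fun p => p + w) '' E n)) := by
    rw [slant_zero_image_add_const]
    exact hs2.image_add_const _
  obtain ⟨T, hT, hTE⟩ := exists_gridSet_approx hr0 k hη0.le (hEc.image (by fun_prop))
    (hs1.image_add_const w) hs2'
  refine ⟨_, ⟨T, Finset.mem_coe.2 (Finset.mem_powerset.2 hT), rfl⟩, hTE.trans ?_⟩
  have hfin : ∀ S, volume (E n \ S) ≠ ∞ := fun S =>
    ((measure_mono Set.sdiff_subset).trans_lt hEc.measure_lt_top).ne
  obtain ⟨p, hp1, hp2⟩ : (Set.Icc (z n).1 ((z n).1 + R) ×ˢ Set.Icc (z n).2 ((z n).2 + R) ∩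
      Set.Icc u (u + R) ×ˢ Set.Icc v (v + R)).Nonempty := by
    by_contra hne
    rw [Set.not_nonempty_iff_eq_empty] at hne
    have hsub : E n ⊆ (E n \ Set.Icc (z n).1 ((z n).1 + R) ×ˢ Set.Icc (z n).2 ((z n).2 + R)) ∪
        (E n \ Set.Icc u (u + R) ×ˢ Set.Icc v (v + R)) := by
      rw [← Set.sdiff_inter, hne, Set.sdiff_empty]
    have := (measureReal_mono (μ := volume) hsub (measure_union_lt_top (hfin _).lt_top
      (hfin _).lt_top).ne).trans (measureReal_union_le _ _)
    linarith
  have hout : volume ((fun p => p + w) '' E n \ Set.Ico 0 (k * r) ×ˢ Set.Ico 0 (k * r)) ≤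
      ENNReal.ofReal η := by
    have hsub : (fun p => p + w) '' E n \ Set.Ico 0 (k * r) ×ˢ Set.Ico 0 (k * r) ⊆
        (fun p => p + w) '' (E n \ Set.Icc u (u + R) ×ˢ Set.Icc v (v + R)) := by
      rintro _ ⟨⟨q, hq, rfl⟩, hqQ⟩
      refine ⟨q, ⟨hq, fun hqI => hqQ ?_⟩, rfl⟩
      obtain ⟨⟨a1, a2⟩, a3, a4⟩ := hp1
      obtain ⟨⟨b1, b2⟩, b3, b4⟩ := hp2
      obtain ⟨⟨c1, c2⟩, c3, c4⟩ := hqI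
      rw [hkr]
      refine ⟨⟨?_, ?_⟩, ?_, ?_⟩ <;> simp only [hw, Prod.fst_add, Prod.snd_add] <;> linarith
    refine (measure_mono hsub).trans ?_
    have : volume ((fun p => p + w) '' (E n \ Set.Icc u (u + R) ×ˢ Set.Icc v (v + R))) =
        volume (E n \ Set.Icc u (u + R) ×ˢ Set.Icc v (v + R)) := by
      rw [Set.image_add_right, measure_preimage_add_right]
    rw [this, ← ofReal_measureReal (hfin _)]
    exact ENNReal.ofReal_le_ofReal huv
  refine (add_le_add_left hout _).trans ?_
  rw [← ENNReal.ofReal_add hη0.le (by positivity), hkr]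
  refine ENNReal.ofReal_le_ofReal ?_
  nlinarith

/-- The map normalizing `A n` serves for `B n` too, since the slice suprema of the two are
comparable; only the translations differ. -/
theorem exists_normalizing_sequence {A B : ℕ → Set (ℝ × ℝ)} {m M : ℝ} (hm : 0 < m)
    (hA : ∀ n, IsCompact (A n))
    (h : ∀ δ > 0, ∀ᶠ n in atTop, NearEquality m M δ (A n) (B n)) :
    ∃ (e : ℕ → (ℝ × ℝ) ≃L[ℝ] (ℝ × ℝ)) (u v : ℕ → ℝ × ℝ),
      (∀ n, MeasurePreserving (e n) volume volume) ∧
      FinitelyApproximable volume (fun n => (fun p => p + u n) '' (e n '' A n)) ∧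
      FinitelyApproximable volume (fun n => (fun p => p + v n) '' (e n '' B n)) := by
  have hex : ∀ n, ∃ e : (ℝ × ℝ) ≃L[ℝ] (ℝ × ℝ), MeasurePreserving e volume volume ∧
      (0 < volume.real (A n) → sliceSup (e '' A n) = 1 ∧
        ∀ s, sliceSup (slant s '' (e '' A n)) ≤ 2 * sliceSup (slant 0 '' (e '' A n))) := by
    intro n
    by_cases hn : 0 < volume.real (A n)
    · obtain ⟨e, h1, h2, h3⟩ := exists_normalization (hA n) hn
      exact ⟨e, h1, fun _ => ⟨h2, h3⟩⟩
    · exact ⟨ContinuousLinearEquiv.refl ℝ _, MeasurePreserving.id _, fun h => absurd h hn⟩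
  choose e he hen using hex
  obtain ⟨κ, hκ, Λ, hΛ, δ0, hδ0, H⟩ := NearEquality.exists_sliceSup_bounds M hm
  have hR : 0 < (M ^ 2 / m + 1) / κ := by positivity
  have key : ∀ η > 0, ∀ᶠ n in atTop,
      (IsCompact (e n '' A n) ∧ m ≤ volume.real (e n '' A n) ∧
      SlicesNearInterval η (e n '' A n) ∧ SlicesNearInterval η (slant 0 '' (e n '' A n)) ∧
      ∃ u v : ℝ, volume.real (e n '' A n \ Set.Icc u (u + (M ^ 2 / m + 1) / κ) ×ˢ
        Set.Icc v (v + (M ^ 2 / m + 1) / κ)) ≤ η) ∧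
      (IsCompact (e n '' B n) ∧ m ≤ volume.real (e n '' B n) ∧
      SlicesNearInterval η (e n '' B n) ∧ SlicesNearInterval η (slant 0 '' (e n '' B n)) ∧
      ∃ u v : ℝ, volume.real (e n '' B n \ Set.Icc u (u + (M ^ 2 / m + 1) / κ) ×ˢ
        Set.Icc v (v + (M ^ 2 / m + 1) / κ)) ≤ η) := by
    intro η hη
    obtain ⟨δ, hδ, H'⟩ := NearEquality.exists_box_and_slices M hm hκ hΛ hη
    filter_upwards [h (min δ0 δ) (by positivity)] with n hn
    have hn' := hn.image (he n)
    obtain ⟨h1, h2⟩ := hen n (hm.trans_le hn.le_left)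
    obtain ⟨⟨a1, a2⟩, b1, b2⟩ := H _ _ (hn'.mono (min_le_left _ _)) h1 h2
    have hn2 := hn'.mono (min_le_right δ0 δ)
    exact ⟨⟨hn'.left_compact, hn'.le_left, H' _ _ hn2 a1 a2⟩,
      hn'.right_compact, hn'.le_right, H' _ _ hn2.symm b1 b2⟩
  obtain ⟨u, hu⟩ := exists_finitelyApproximable_translates hR hm
    fun η hη => (key η hη).mono fun n hn => hn.1
  obtain ⟨v, hv⟩ := exists_finitelyApproximable_translates hR hm
    fun η hη => (key η hη).mono fun n hn => hn.2
  exact ⟨e, u, v, he, hu, hv⟩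

/-! ### Transfer to the Euclidean plane and conclusion. -/

/-- The identification of the plane with `ℝ × ℝ`. -/
noncomputable def planeEquivProd : Plane ≃L[ℝ] (ℝ × ℝ) :=
  (EuclideanSpace.equiv (Fin 2) ℝ).trans (ContinuousLinearEquiv.finTwoArrow ℝ ℝ)

theorem measurePreserving_planeEquivProd : MeasurePreserving planeEquivProd volume volume :=
  (volume_preserving_finTwoArrow ℝ).comp
    (EuclideanSpace.volume_preserving_symm_measurableEquiv_toLp (Fin 2))

theorem volume_image_planeEquivProd (S : Set Plane) :
    volume (planeEquivProd '' S) = volume S := by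
  have h : MeasurePreserving planeEquivProd.toHomeomorph.toMeasurableEquiv volume volume :=
    measurePreserving_planeEquivProd
  rw [← h.measure_preimage_equiv (planeEquivProd '' S)]
  congr 1
  exact planeEquivProd.injective.preimage_image S

/-- The identification of the plane with `ℝ × ℝ`, followed by a homothety. -/
noncomputable def planeScale {c : ℝ} (hc : c ≠ 0) : Plane ≃L[ℝ] (ℝ × ℝ) :=
  planeEquivProd.trans (ContinuousLinearEquiv.smulLeft (Units.mk0 c hc))

@[simp]
theorem planeScale_apply {c : ℝ} (hc : c ≠ 0) (x : Plane) :
    planeScale hc x = c • planeEquivProd x := rfl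

theorem volume_image_planeScale {c : ℝ} (hc : c ≠ 0) (S : Set Plane) :
    volume (planeScale hc '' S) = ENNReal.ofReal (c ^ 2) * volume S := by
  have : planeScale hc '' S = c • (planeEquivProd '' S) := by
    rw [← Set.image_smul, Set.image_image]
    rfl
  rw [this, Measure.addHaar_smul, volume_image_planeEquivProd]
  simp

theorem measureReal_image_planeScale {c : ℝ} (hc : c ≠ 0) (S : Set Plane) :
    volume.real (planeScale hc '' S) = c ^ 2 * volume.real S := by
  rw [measureReal_def, volume_image_planeScale, ENNReal.toReal_mul,
    ENNReal.toReal_ofReal (by positivity), measureReal_def]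

theorem exists_isCompact_subset_measure_diff_le {A : Set Plane}
    (hA : NullMeasurableSet A (volume : Measure Plane)) (hfin : volume A ≠ ∞) {ε : ℝ≥0∞}
    (hε : ε ≠ 0) : ∃ K ⊆ A, IsCompact K ∧ volume (A \ K) ≤ ε := by
  obtain ⟨F, hFA, hF, hFe⟩ := hA.exists_measurable_subset_ae_eq
  have hFfin : volume F ≠ ∞ := by rwa [measure_congr hFe]
  obtain ⟨K, hKF, hK, hKε⟩ := hF.exists_isCompact_sdiff_lt hFfin hε
  refine ⟨K, hKF.trans hFA, hK, ?_⟩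
  have hsub : A \ K ⊆ (A \ F) ∪ (F \ K) := by
    intro x hx
    by_cases h : x ∈ F
    · exact Or.inr ⟨h, hx.2⟩
    · exact Or.inl ⟨hx.1, h⟩
  have h0 : volume (A \ F) = 0 := (ae_le_set.1 hFe.symm.le)
  calc volume (A \ K) ≤ volume (A \ F) + volume (F \ K) :=
        (measure_mono hsub).trans (measure_union_le _ _)
    _ ≤ ε := by rw [h0, zero_add]; exact hKε.le

theorem tendsto_measureReal_of_diff {A K : ℕ → Set Plane} (hKA : ∀ n, K n ⊆ A n)
    (hAfin : ∀ n, volume (A n) ≠ ∞) (hd : Tendsto (fun n => volume (A n \ K n)) atTop (𝓝 0))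
    (hA : Tendsto (fun n => volume (A n)) atTop (𝓝 1)) :
    Tendsto (fun n => volume.real (K n)) atTop (𝓝 1) := by
  have h1 : Tendsto (fun n => volume.real (A n)) atTop (𝓝 1) := by
    simpa [measureReal_def, Function.comp_def] using (ENNReal.tendsto_toReal ENNReal.one_ne_top).comp hA
  have h2 : Tendsto (fun n => volume.real (A n \ K n)) atTop (𝓝 0) := by
    simpa [measureReal_def, Function.comp_def] using (ENNReal.tendsto_toReal ENNReal.zero_ne_top).comp hd
  have h3 : Tendsto (fun n => volume.real (A n) - volume.real (A n \ K n)) atTop (𝓝 1) := by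
    simpa using h1.sub h2
  refine tendsto_of_tendsto_of_tendsto_of_le_of_le h3 h1 (fun n => ?_) fun n =>
    measureReal_mono (hKA n) (hAfin n)
  have hKfin : volume (K n) ≠ ∞ := ((measure_mono (hKA n)).trans_lt (hAfin n).lt_top).ne
  have hsub : A n ⊆ (A n \ K n) ∪ K n := fun x hx => by
    by_cases h : x ∈ K n
    · exact Or.inr h
    · exact Or.inl ⟨hx, h⟩
  have h4 := (measureReal_mono (μ := volume) hsub (measure_union_lt_top
    ((measure_mono Set.sdiff_subset).trans_lt (hAfin n).lt_top) hKfin.lt_top).ne).trans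
    (measureReal_union_le _ _)
  simp only
  linarith

/-- The factors `t` and `1 - t` are absorbed into the sets, so the Brunn-Minkowski bound tends to
$(t+(1-t))^2=1$, the limit of the measures of `S n`. -/
theorem eventually_nearEquality {t : ℝ} (ht0 : t ≠ 0) (ht1 : 1 - t ≠ 0) (h0 : 0 < t) (h1 : t < 1)
    {K L : ℕ → Set Plane} {S : ℕ → Set Plane} (hK : ∀ n, IsCompact (K n))
    (hL : ∀ n, IsCompact (L n)) (hK1 : Tendsto (fun n => volume.real (K n)) atTop (𝓝 1))
    (hL1 : Tendsto (fun n => volume.real (L n)) atTop (𝓝 1))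
    (hS : ∀ n, t • K n + (1 - t) • L n ⊆ S n)
    (hS1 : Tendsto (fun n => volume (S n)) atTop (𝓝 1)) {δ : ℝ} (hδ : 0 < δ) :
    ∀ᶠ n in atTop, NearEquality (min (t ^ 2) ((1 - t) ^ 2) / 2) 2 δ (planeScale ht0 '' K n)
      (planeScale ht1 '' L n) := by
  have h1' : 0 < 1 - t := by linarith
  have hSr : Tendsto (fun n => volume.real (S n)) atTop (𝓝 1) := by
    simpa [measureReal_def, Function.comp_def] using (ENNReal.tendsto_toReal ENNReal.one_ne_top).comp hS1
  have hlim : Tendsto (fun n => (√(t ^ 2 * volume.real (K n)) +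
      √((1 - t) ^ 2 * volume.real (L n))) ^ 2 + δ - volume.real (S n)) atTop (𝓝 δ) := by
    have h2 := ((((hK1.const_mul (t ^ 2)).sqrt.add (hL1.const_mul ((1 - t) ^ 2)).sqrt).pow
      2).add_const δ).sub hSr
    have e : (√(t ^ 2 * 1) + √((1 - t) ^ 2 * 1)) ^ 2 + δ - 1 = δ := by
      rw [mul_one, mul_one, Real.sqrt_sq h0.le, Real.sqrt_sq h1'.le]
      ring
    rwa [e] at h2
  filter_upwards [hlim.eventually (lt_mem_nhds hδ), hK1.eventually (lt_mem_nhds one_half_lt_one),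
    hL1.eventually (lt_mem_nhds one_half_lt_one), hSr.eventually (gt_mem_nhds one_lt_two),
    hS1.eventually (gt_mem_nhds ENNReal.one_lt_top)] with n a1 a2 a3 a4 a5
  have hsum : planeScale ht0 '' K n + planeScale ht1 '' L n =
      planeEquivProd '' (t • K n + (1 - t) • L n) := by
    rw [Set.image_add, ← Set.image_smul, ← Set.image_smul, Set.image_image, Set.image_image]
    simp only [map_smul]
    rfl
  have hle : volume.real (planeScale ht0 '' K n + planeScale ht1 '' L n) ≤ volume.real (S n) := by
    rw [hsum, measureReal_def, volume_image_planeEquivProd]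
    exact measureReal_mono (hS n) a5.ne
  refine ⟨(hK n).image (planeScale ht0).continuous, (hL n).image (planeScale ht1).continuous,
    ?_, ?_, hle.trans a4.le, ?_⟩
  · rw [measureReal_image_planeScale]
    have := min_le_left (t ^ 2) ((1 - t) ^ 2)
    have : 0 < t ^ 2 := by positivity
    nlinarith
  · rw [measureReal_image_planeScale]
    have := min_le_right (t ^ 2) ((1 - t) ^ 2)
    have : 0 < (1 - t) ^ 2 := by positivity
    nlinarith
  · rw [measureReal_image_planeScale, measureReal_image_planeScale]
    linarith

/-- The affine automorphism of the plane with linear part corresponding to `e` and with constant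
term `c`. -/
noncomputable def planeAffine (e : (ℝ × ℝ) ≃L[ℝ] (ℝ × ℝ)) (c : Plane) : Plane ≃ᵃ[ℝ] Plane :=
  ((planeEquivProd.trans e).trans planeEquivProd.symm).toLinearEquiv.toAffineEquiv.trans
    (AffineEquiv.constVAdd ℝ Plane c)

theorem planeAffine_apply (e : (ℝ × ℝ) ≃L[ℝ] (ℝ × ℝ)) (c x : Plane) :
    planeAffine e c x = c + planeEquivProd.symm (e (planeEquivProd x)) := rfl

theorem measurePreserving_planeAffine {e : (ℝ × ℝ) ≃L[ℝ] (ℝ × ℝ)}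
    (he : MeasurePreserving e volume volume) (c : Plane) :
    MeasurePreserving (planeAffine e c) volume volume := by
  have h : MeasurePreserving planeEquivProd.toHomeomorph.toMeasurableEquiv volume volume :=
    measurePreserving_planeEquivProd
  have h1 : MeasurePreserving planeEquivProd.symm volume volume := h.symm
  exact (measurePreserving_add_left volume c).comp
    ((h1.comp he).comp measurePreserving_planeEquivProd)

/-- The homothety commutes with linear maps, so undoing it only divides the translation by `s`; the
same linear part thus serves both sequences despite their different factors. -/
theorem planeScale_planeAffine {s : ℝ} (hs : s ≠ 0) (e : (ℝ × ℝ) ≃L[ℝ] (ℝ × ℝ)) (u : ℝ × ℝ)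
    (x : Plane) :
    planeScale hs (planeAffine e (planeEquivProd.symm (s⁻¹ • u)) x) =
      e (planeScale hs x) + u := by
  rw [planeAffine_apply, planeScale_apply, planeScale_apply, map_add, smul_add,
    ContinuousLinearEquiv.apply_symm_apply, ContinuousLinearEquiv.apply_symm_apply, smul_smul,
    mul_inv_cancel₀ hs, one_smul, map_smul, add_comm]

theorem precompactInL2_planeAffine {s : ℝ} (hs : s ≠ 0) {A K : ℕ → Set Plane}
    {e : ℕ → (ℝ × ℝ) ≃L[ℝ] (ℝ × ℝ)} {u : ℕ → ℝ × ℝ}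
    (he : ∀ n, MeasurePreserving (e n) volume volume)
    (hA : ∀ n, NullMeasurableSet (A n) (volume : Measure Plane))
    (hfin : ∀ n, volume (A n) ≠ ∞) (hKA : ∀ n, K n ⊆ A n)
    (hd : Tendsto (fun n => volume (A n \ K n)) atTop (𝓝 0))
    (h : FinitelyApproximable volume
      fun n => (fun p => p + u n) '' (e n '' (planeScale hs '' K n))) :
    PrecompactInL2 fun n =>
      indicatorFun (planeAffine (e n) (planeEquivProd.symm (s⁻¹ • u n)) '' A n) := by
  set Φ := fun n => planeAffine (e n) (planeEquivProd.symm (s⁻¹ • u n)) with hΦ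
  have hvol : ∀ n S, volume (Φ n '' S) = volume S := by
    intro n S
    have h : MeasurePreserving (Φ n).toContinuousAffineEquiv.toHomeomorph.toMeasurableEquiv volume
      volume := measurePreserving_planeAffine (he n) _
    rw [← h.measure_preimage_equiv (Φ n '' S)]
    congr 1
    exact (Φ n).injective.preimage_image S
  have hK : FinitelyApproximable (volume : Measure Plane) fun n => Φ n '' K n := by
    refine FinitelyApproximable.of_image (planeScale hs).toHomeomorph.toMeasurableEquiv
      (by positivity : 0 < s ^ 2) (volume_image_planeScale hs) ?_
    have himage : (fun n => (planeScale hs).toHomeomorph.toMeasurableEquiv '' (Φ n '' K n)) =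
        fun n => (fun p => p + u n) '' (e n '' (planeScale hs '' K n)) := by
      funext n
      rw [Set.image_image, Set.image_image, Set.image_image]
      exact Set.image_congr fun x _ => planeScale_planeAffine hs (e n) (u n) x
    exact himage ▸ h
  refine FinitelyApproximable.precompactInL2 (hK.congr_of_tendsto ?_) (fun n => ?_) fun n => ?_
  · convert hd using 2 with n
    rw [← Set.image_symmDiff (Φ n).injective, hvol, symmDiff_of_ge (hKA n)]
  · have h : MeasurePreserving (Φ n).toContinuousAffineEquiv.toHomeomorph.toMeasurableEquiv volume
      volume := measurePreserving_planeAffine (he n) _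
    have h2 := (hA n).preimage h.symm.quasiMeasurePreserving
    rwa [← MeasurableEquiv.image_eq_preimage_symm] at h2
  · rw [hvol]
    exact hfin n

theorem mainTheorem3 (t : ℝ) (ht0 : 0 < t) (ht1 : t < 1)
    (A B : ℕ → Set Plane)
    (hAmeas : ∀ n, NullMeasurableSet (A n) (volume : Measure Plane))
    (hBmeas : ∀ n, NullMeasurableSet (B n) (volume : Measure Plane))
    (hAfin : ∀ n, volume (A n) ≠ ∞)
    (hBfin : ∀ n, volume (B n) ≠ ∞)
    (hA : Tendsto (fun n => volume (A n)) atTop (𝓝 1))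
    (hB : Tendsto (fun n => volume (B n)) atTop (𝓝 1))
    (hAB : Tendsto (fun n => volume (t • A n + (1 - t) • B n)) atTop (𝓝 1)) :
    ∃ (Φ : ℕ → (Plane ≃ᵃ[ℝ] Plane)) (v : ℕ → Plane),
      (∀ n, MeasurePreserving (Φ n) (volume : Measure Plane) (volume : Measure Plane)) ∧
      PrecompactInL2 (fun n => indicatorFun (Φ n '' A n)) ∧
      PrecompactInL2 (fun n => indicatorFun ((fun x => Φ n x + v n) '' B n)) := by
  have hs : t ≠ 0 := ht0.ne'
  have hs' : 1 - t ≠ 0 := by linarith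
  have hinv : ∀ n : ℕ, ((n : ℝ≥0∞) + 1)⁻¹ ≠ 0 := fun n =>
    ENNReal.inv_ne_zero.2 (by finiteness)
  -- Compact subsets with loss at most $1/(n+1)$ keep the limiting measures, and their sumsets are
  -- contained in the given ones.
  choose K hKA hKc hKd using fun n =>
    exists_isCompact_subset_measure_diff_le (hAmeas n) (hAfin n) (hinv n)
  choose L hLB hLc hLd using fun n =>
    exists_isCompact_subset_measure_diff_le (hBmeas n) (hBfin n) (hinv n)
  have hlim : Tendsto (fun n : ℕ => ((n : ℝ≥0∞) + 1)⁻¹) atTop (𝓝 0) := by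
    have := (tendsto_add_atTop_iff_nat 1).2 ENNReal.tendsto_inv_nat_nhds_zero
    simpa using this
  have hKd0 := tendsto_of_tendsto_of_tendsto_of_le_of_le tendsto_const_nhds hlim
    (fun _ => zero_le) hKd
  have hLd0 := tendsto_of_tendsto_of_tendsto_of_le_of_le tendsto_const_nhds hlim
    (fun _ => zero_le) hLd
  have hm : 0 < min (t ^ 2) ((1 - t) ^ 2) / 2 := by positivity
  obtain ⟨e, u, w, he, hu, hw⟩ := exists_normalizing_sequence
    (A := fun n => planeScale hs '' K n) (B := fun n => planeScale hs' '' L n) (M := 2) hm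
    (fun n => (hKc n).image (planeScale hs).continuous) fun δ hδ =>
      eventually_nearEquality hs hs' ht0 ht1 hKc hLc
        (tendsto_measureReal_of_diff hKA hAfin hKd0 hA)
        (tendsto_measureReal_of_diff hLB hBfin hLd0 hB)
        (fun n => Set.add_subset_add (Set.smul_set_mono (hKA n)) (Set.smul_set_mono (hLB n)))
        hAB hδ
  set c := fun n => planeEquivProd.symm (t⁻¹ • u n) with hc
  set d := fun n => planeEquivProd.symm ((1 - t)⁻¹ • w n) with hd
  -- `Φ` carries the translation adapted to `A n`; the vector `d n - c n` replaces it by the one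
  -- adapted to `B n`.
  refine ⟨fun n => planeAffine (e n) (c n), fun n => d n - c n,
    fun n => measurePreserving_planeAffine (he n) _,
    precompactInL2_planeAffine hs he hAmeas hAfin hKA hKd0 hu, ?_⟩
  have h2 := precompactInL2_planeAffine hs' he hBmeas hBfin hLB hLd0 hw
  have e2 : ∀ n, (fun x => planeAffine (e n) (c n) x + (d n - c n)) '' B n =
      planeAffine (e n) (d n) '' B n := fun n => Set.image_congr fun x _ => by
    rw [planeAffine_apply, planeAffine_apply]
    abel
  simp only [e2]
  exact h2
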